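/- **Setting.** Let $\Bbbk$ be a field of characteristic $\neq 2$ and let $0<i<n$ be integers. Let $\mathcal C$ be the $\Bbbk$-linear category with objects $T_0,\dots,T_n$ and $\mathrm{Hom}(T_j,T_k)=\bigoplus_{\alpha\ge 0}\Bbbk\,a_{kj}s^{\alpha}$, with composition $$a_{lk}s^{\beta}\cdot a_{kj}s^{\alpha}=a_{lj}s^{\alpha+\beta+\delta},\qquad \delta=\begin{cases}0,&(j-k)(k-l)\ge 0,\\ \min(|j-k|,|k-l|),&(j-k)(k-l)<0,\end{cases}$$ and identities $a_{jj}s^0$. Write $s_j^{\ell}=a_{jj}s^{\ell}$, $q_{i-1}=a_{i-1,i}$, $p_{i+1}=a_{i+1,i}$. Regard $\mathcal C$ as an $A_\infty$-category with all morphisms in degree $0$, $\mu^2(b,a)=ba$ and $\mu^d=0$ for $d\ne 2$. Let $\mathrm{Tw}^b(\mathcal C)$ be the category of bounded twisted complexes $(X,\delta)$ over $\mathcal C$, with $\mu^1(\varphi)=(-1)^{|\varphi|}\delta\varphi-\varphi\delta$, $\mu^2(\psi,\varphi)=(-1)^{|\varphi|}\psi\varphi$ and $\mu^{d}=0$ for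 $d\ge 3$. The *negative braiding functor* $\beta_i^-:\mathcal C\to\mathrm{Tw}^b(\mathcal C)$ is the following $A_\infty$-functor. * $\beta_i^-T_j=T_j$ for $j\ne i$, and $\beta_i^-T_i=\big(T_i\xrightarrow{[\,a_{i-1,i},\,-a_{i+1,i}\,]}T_{i-1}\oplus T_{i+1}\big)$ in degrees $-1,0$. * $(\beta_i^-)^1(a_{kj}s^\alpha)=a_{kj}s^\alpha$ for $j,k\neq i$. $(\beta_i^-)^1(a_{ij}s^\alpha)$ is $a_{i-1,j}s^\alpha$ into $T_{i-1}$ if $j<i$, and $a_{i+1,j}s^\alpha$ into $T_{i+1}$ if $j>i$. $(\beta_i^-)^1(a_{ki}s^\alpha)$ is $[a_{k,i-1}s^\alpha,\ a_{k,i+1}s^{\alpha+1}]$ if $k>i$ and $[a_{k,i-1}s^{\alpha+1},\ a_{k,i+1}s^{\alpha}]$ if $k<i$. $(\beta_i^-)^1(a_{ii}s^\alpha)$ is multiplication by $s^\alpha$ on each of the three summands. * $(\beta_i^-)^2(a_{lk}s^{\beta},a_{kj}s^{\alpha})=0$ if $l\neq i$. If $l=i$ and $j\neq i$, it is $\mathrm{sgn}(i-k)\,a_{ij}s^{\alpha+\beta+|i-k|-1}$,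 into the summand $T_i$ of $\beta_i^-T_i$, when $(i-j)(i-k)<0$, and $0$ otherwise. If $l=j=i$, it is $\mathrm{sgn}(i-k)\,a_{i,i+\mathrm{sgn}(i-k)}s^{\alpha+\beta+|i-k|-1}$, from the summand $T_{i+\mathrm{sgn}(i-k)}$ to the summand $T_i$, when $k\ne i$, and $0$ when $k=i$. * $(\beta_i^-)^d=0$ for $d\ge 3$. Let $\mathrm{id}$ denote the inclusion $\mathcal C\to\mathrm{Tw}^b(\mathcal C)$. A pre-natural transformation $\eta:\mathrm{id}\Rightarrow\beta_i^-$ of degree $g$ consists of multilinear maps $\eta^d$ ($d\ge 0$) of degree $g-d$, from chains of $d$ composable morphisms $T_{j_0}\to\cdots\to T_{j_d}$ to $\mathrm{Hom}(T_{j_0},\beta_i^-T_{j_d})$. These form a complex under the differential $\mu^1$ of the $A_\infty$-category of $A_\infty$-functors. The $A_\infty$-natural transformations are its cocycles, and $\mathrm{HH}^0(\mathfrak B_{i^-})$ is its cohomology in degree $0$. **Theorem.** For every finitely supported sequence $\epsilon=\{\epsilon_\ell\}_{\ell\ge1}\in\Bbbk^{\mathbb Z_{\ge1}}=\bigoplus_{\ell\ge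 1}\Bbbk$ let $\eta_\epsilon$ be the family with $$\eta_\epsilon^0(T_j)=\begin{cases}\sum_{\ell\ge1}\epsilon_\ell\,s_j^{\ell},&j\ne i,\\[2pt] \sum_{\ell\ge1}\epsilon_\ell\big[\tfrac12 q_{i-1}s^{\ell-1},\ \tfrac12 p_{i+1}s^{\ell-1}\big],&j=i,\end{cases}$$ $$\eta_\epsilon^1(a_{kj}s^\alpha)=\begin{cases}0,&k\neq i,\\[2pt] \mathrm{sgn}(i-j)\sum_{\ell\ge1}\tfrac12\epsilon_\ell\,a_{ij}s^{\alpha+\ell-1},&k=i,\end{cases}$$ where the last morphism maps into the degree $-1$ summand $T_i$ of $\beta_i^-T_i$, and $\eta_\epsilon^d=0$ for $d\ge2$. Then: 1. each $\eta_\epsilon$ is an $A_\infty$-natural transformation $\mathrm{id}\Rightarrow\beta_i^-$ of degree $0$, and $\epsilon\mapsto[\eta_\epsilon]$ is an isomorphism of vector spaces $\Bbbk^{\mathbb Z_{\ge1}}\cong\mathrm{HH}^0(\mathfrak B_{i^-})$; that is, every degree-$0$ natural transformation $\mathrm{id}\Rightarrow\beta_i^-$ is cohomologous to exactly one $\eta_\epsilon$;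 2. if $\epsilon\ne0$, then $\eta_\epsilon^1\neq0$. -/

import Mathlib

open CategoryTheory Polynomial

universe v u

namespace Braid

/-! ### Chains of composable morphisms -/

section Chains

variable {C : Type u} [Category.{v} C]

/-- All ways of cutting a chain `(a_d, …, a_1)` of composable morphisms into an initial part
`(a_s, …, a_1)` and a final part `(a_d, …, a_{s+1})`, for `0 ≤ s ≤ d`.  A chain is a
`Quiver.Path`; its first arrow is `a_1`. -/
def splits : ∀ {X Y : C}, Quiver.Path X Y → List (Σ Z : C, Quiver.Path X Z × Quiver.Path Z Y)
  | _, _, .nil => [⟨_, .nil, .nil⟩]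
  | _, _, .cons p f =>
      (splits p).map (fun s => ⟨s.1, s.2.1, s.2.2.cons f⟩) ++ [⟨_, p.cons f, .nil⟩]

/-- All chains `(a_d, …, a_{n+3}, a_{n+2} a_{n+1}, a_n, …, a_1)` obtained from `(a_d, …, a_1)` by
composing two neighbours, each listed with its number `n`, for `0 ≤ n ≤ d - 2`. -/
def contractions : ∀ {X Y : C}, Quiver.Path X Y → List (ℕ × Quiver.Path X Y)
  | _, _, .nil => []
  | _, _, .cons .nil _ => []
  | _, _, .cons (.cons p f) g =>
      (contractions (p.cons f)).map (fun c => (c.1, c.2.cons g)) ++ [(p.length, p.cons (f ≫ g))]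

theorem length_of_mem_splits {X Y : C} (p : Quiver.Path X Y) :
    ∀ s ∈ splits p, s.2.1.length + s.2.2.length = p.length := by
  induction p with
  | nil => intro s hs; simp [splits] at hs; subst hs; rfl
  | cons p f ih =>
    intro s hs
    simp only [splits, List.mem_append, List.mem_map, List.mem_singleton] at hs
    rcases hs with ⟨t, ht, rfl⟩ | rfl
    · have := ih t ht
      simp only [Quiver.Path.length_cons]; omega
    · simp

theorem length_of_mem_contractions {X Y : C} (p : Quiver.Path X Y) :
    ∀ c ∈ contractions p, c.2.length + 1 = p.length := by
  induction p with
  | nil => intro c hc; simp [contractions] at hc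
  | cons p f ih =>
    intro c hc
    cases p with
    | nil => simp [contractions] at hc
    | cons p e =>
      simp only [contractions, List.mem_append, List.mem_map, List.mem_singleton] at hc
      rcases hc with ⟨t, ht, rfl⟩ | rfl
      · have := ih t ht
        simp only [Quiver.Path.length_cons] at this ⊢; omega
      · simp

end Chains

/-! ### Bounded twisted complexes

Let `C` be a linear category, regarded as an `A∞`-category whose morphisms all have degree `0` and
whose only structure map is the composition `μ²`. -/

/-- A bounded twisted complex over `C`: finitely many summands `obj a`, placed in degree `deg a`,
with a bounding cochain `δ` of degree `1` that satisfies the Maurer-Cartan equation `δ ∘ δ = 0`. -/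
structure Tw (C : Type u) [Category.{v} C] [Preadditive C] where
  ι : Type
  [fin : Fintype ι]
  obj : ι → C
  deg : ι → ℤ
  δ : ∀ a b, obj a ⟶ obj b
  δ_deg : ∀ a b, deg b ≠ deg a + 1 → δ a b = 0
  δ_sq : ∀ a c, ∑ b, δ a b ≫ δ b c = 0

attribute [instance] Tw.fin

namespace Tw

variable {C : Type u} [Category.{v} C] [Preadditive C]

/-- The total space of morphisms between twisted complexes: matrices of morphisms of `C`. The entry
from the summand `a` to the summand `b` has degree `Y.deg b - X.deg a`. -/
abbrev Hom (X Y : Tw C) : Type v := ∀ (a : X.ι) (b : Y.ι), X.obj a ⟶ Y.obj b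

/-- `φ` is homogeneous of degree `g`. -/
def Hom.HasDeg {X Y : Tw C} (φ : Hom X Y) (g : ℤ) : Prop :=
  ∀ a b, Y.deg b ≠ X.deg a + g → φ a b = 0

/-- The differential `μ¹(φ) = (-1)^{|φ|} δ φ - φ δ` of twisted complexes. -/
def μ₁ {X Y : Tw C} (φ : Hom X Y) : Hom X Y := fun a c =>
  ∑ b, (Y.deg b - X.deg a).negOnePow • (φ a b ≫ Y.δ b c) - ∑ b, X.δ a b ≫ φ b c

/-- The product `μ²(ψ, φ) = (-1)^{|φ|} ψ φ` of twisted complexes. -/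
def μ₂ {X Y Z : Tw C} (ψ : Hom Y Z) (φ : Hom X Y) : Hom X Z := fun a c =>
  ∑ b, (Y.deg b - X.deg a).negOnePow • (φ a b ≫ ψ b c)

/-- An object of `C` as a twisted complex with one summand, in degree `0`. -/
def single (X : C) : Tw C where
  ι := Unit
  obj _ := X
  deg _ := 0
  δ _ _ := 0
  δ_deg _ _ _ := rfl
  δ_sq _ _ := by simp

@[simp] theorem μ₁_zero {X Y : Tw C} : μ₁ (0 : Hom X Y) = 0 := by
  funext a c; simp [μ₁]

@[simp] theorem μ₂_zero_left {X Y Z : Tw C} (φ : Hom X Y) : μ₂ (0 : Hom Y Z) φ = 0 := by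
  funext a c; simp [μ₂]

@[simp] theorem μ₂_zero_right {X Y Z : Tw C} (ψ : Hom Y Z) : μ₂ ψ (0 : Hom X Y) = 0 := by
  funext a c; simp [μ₂]

@[simp] theorem single_δ (X : C) (a b : (single X).ι) : (single X).δ a b = 0 := rfl

@[simp] theorem single_deg (X : C) (a : (single X).ι) : (single X).deg a = 0 := rfl

theorem single_sum {M : Type*} [AddCommMonoid M] (X : C) (f : (single X).ι → M) :
    ∑ a, f a = f () := by
  exact Fintype.sum_unique (ι := Unit) f

theorem μ₁_add {X Y : Tw C} (φ φ' : Hom X Y) : μ₁ (φ + φ') = μ₁ φ + μ₁ φ' := by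
  funext a c
  simp only [μ₁, Pi.add_apply, Preadditive.add_comp, Preadditive.comp_add, smul_add,
    Finset.sum_add_distrib]
  abel

theorem μ₂_add_left {X Y Z : Tw C} (ψ ψ' : Hom Y Z) (φ : Hom X Y) :
    μ₂ (ψ + ψ') φ = μ₂ ψ φ + μ₂ ψ' φ := by
  funext a c
  simp only [μ₂, Pi.add_apply, Preadditive.comp_add, smul_add, Finset.sum_add_distrib]

theorem μ₂_add_right {X Y Z : Tw C} (ψ : Hom Y Z) (φ φ' : Hom X Y) :
    μ₂ ψ (φ + φ') = μ₂ ψ φ + μ₂ ψ φ' := by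
  funext a c
  simp only [μ₂, Pi.add_apply, Preadditive.add_comp, smul_add, Finset.sum_add_distrib]

section

variable {k : Type*} [Field k] [Linear k C]

theorem list_sum_smul {A M : Type*} [AddCommGroup M] [Module k M] (r : k) (l : List A)
    (f : A → M) : (l.map fun x => r • f x).sum = r • (l.map f).sum := by
  induction l with
  | nil => simp
  | cons x l ih => simp [ih, smul_add]

theorem μ₁_smul {X Y : Tw C} (r : k) (φ : Hom X Y) : μ₁ (r • φ) = r • μ₁ φ := by
  funext a c
  simp only [μ₁, Pi.smul_apply, Linear.smul_comp, Linear.comp_smul, smul_sub, Finset.smul_sum,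
    Units.smul_def, smul_comm r]

theorem μ₂_smul_left {X Y Z : Tw C} (r : k) (ψ : Hom Y Z) (φ : Hom X Y) :
    μ₂ (r • ψ) φ = r • μ₂ ψ φ := by
  funext a c
  simp only [μ₂, Pi.smul_apply, Linear.comp_smul, Finset.smul_sum, Units.smul_def, smul_comm r]

theorem μ₂_smul_right {X Y Z : Tw C} (r : k) (ψ : Hom Y Z) (φ : Hom X Y) :
    μ₂ ψ (r • φ) = r • μ₂ ψ φ := by
  funext a c
  simp only [μ₂, Pi.smul_apply, Linear.smul_comp, Finset.smul_sum, Units.smul_def, smul_comm r]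

end

end Tw

/-! ### `A∞`-functors `C → Tw C` and their natural transformations -/

section Functors

variable (k : Type*) [Field k] (C : Type u) [Category.{v} C] [Preadditive C] [Linear k C]

/-- An `A∞`-functor from `C` to its category of bounded twisted complexes. The component `F^d` is
the restriction of `map` to the chains of length `d`; there is no component `F^0`. The equations
are the general ones
`∑ μ^r(F^{i_r}(…), …, F^{i_1}(…)) = ∑ (-1)^{✠_n} F^{d-m+1}(…, μ^m(…), a_n, …, a_1)`,
in which `✠_n = |a_1| + ⋯ + |a_n| - n = -n`, only `μ²` is nonzero in `C`, and only `μ¹` and `μ²` are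
nonzero for twisted complexes. -/
structure AInfFunctor where
  obj : C → Tw C
  map : ∀ {X Y : C}, Quiver.Path X Y → Tw.Hom (obj X) (obj Y)
  map_nil : ∀ X : C, map (Quiver.Path.nil : Quiver.Path X X) = 0
  map_linear : ∀ {X Y Z W : C} (p : Quiver.Path X Y) (q : Quiver.Path Z W),
    IsLinearMap k (fun f : Y ⟶ Z => map ((p.cons f).comp q))
  map_deg : ∀ {X Y : C} (p : Quiver.Path X Y), (map p).HasDeg (1 - p.length)
  map_rel : ∀ {X Y : C} (p : Quiver.Path X Y),
    Tw.μ₁ (map p) + ((splits p).map fun s => Tw.μ₂ (map s.2.2) (map s.2.1)).sum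
      = ((contractions p).map fun c => (-(c.1 : ℤ)).negOnePow • map c.2).sum

variable {k C}

/-- Families of maps that assign to a chain of composable morphisms from `X` to `Y` a morphism
`F X → G Y`. -/
abbrev Family (F G : AInfFunctor k C) : Type _ :=
  ∀ (X Y : C), Quiver.Path X Y → Tw.Hom (F.obj X) (G.obj Y)

/-- Pre-natural transformations of degree `g`: the component `η^d`, the restriction of `η` to the
chains of length `d ≥ 0`, is multilinear and takes values in degree `g - d`. -/
def preNat (F G : AInfFunctor k C) (g : ℤ) : Submodule k (Family F G) where
  carrier := {η |
    (∀ {X Y Z W : C} (p : Quiver.Path X Y) (q : Quiver.Path Z W),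
      IsLinearMap k (fun f : Y ⟶ Z => η X W ((p.cons f).comp q))) ∧
    ∀ {X Y : C} (p : Quiver.Path X Y), (η X Y p).HasDeg (g - p.length)}
  add_mem' := by
    rintro η θ ⟨h1, h2⟩ ⟨h3, h4⟩
    refine ⟨fun {X Y Z W} p q => ⟨fun f f' => ?_, fun c f => ?_⟩, fun p a b hab => ?_⟩
    · have e1 := (h1 p q).map_add f f'
      have e2 := (h3 p q).map_add f f'
      simp only [Pi.add_apply] at e1 e2 ⊢
      rw [e1, e2]; abel
    · have e1 := (h1 p q).map_smul c f
      have e2 := (h3 p q).map_smul c f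
      simp only [Pi.add_apply] at e1 e2 ⊢
      rw [e1, e2, smul_add]
    · simp [h2 p a b hab, h4 p a b hab]
  zero_mem' := ⟨fun p q => ⟨by simp, by simp⟩, fun p a b _ => rfl⟩
  smul_mem' := by
    rintro r η ⟨h1, h2⟩
    refine ⟨fun {X Y Z W} p q => ⟨fun f f' => ?_, fun c f => ?_⟩, fun p a b hab => ?_⟩
    · have e1 := (h1 p q).map_add f f'
      simp only [Pi.smul_apply] at e1 ⊢
      rw [e1, smul_add]
    · have e1 := (h1 p q).map_smul c f
      simp only [Pi.smul_apply] at e1 ⊢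
      rw [e1, smul_comm]
    · simp [h2 p a b hab]

/-- The differential `μ¹` of the functor category on pre-natural transformations of degree `g`,
evaluated on a chain `(a_d, …, a_1)`. In the general formula
`∑ (-1)^† μ^r(G(…), …, G(…), η(…), F(…), …, F(…)) - ∑ (-1)^{✠_n + g - 1} η(…, μ^m(…), a_n, …, a_1)`
one has `† = (g - 1)(-s)`, where `s` is the number of morphisms to the right of `η(…)`. -/
def natDiffFun (F G : AInfFunctor k C) (g : ℤ) (η : Family F G) : Family F G := fun X Y p =>
  Tw.μ₁ (η X Y p)
    + ((splits p).map fun s => Tw.μ₂ (G.map s.2.2) (η X s.1 s.2.1)).sum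
    + ((splits p).map fun s =>
        ((g - 1) * -(s.2.1.length : ℤ)).negOnePow • Tw.μ₂ (η s.1 Y s.2.2) (F.map s.2.1)).sum
    - ((contractions p).map fun c => (-(c.1 : ℤ) + g - 1).negOnePow • η X Y c.2).sum

/-- `natDiffFun` as a linear map. -/
def natDiff (F G : AInfFunctor k C) (g : ℤ) : Family F G →ₗ[k] Family F G where
  toFun := natDiffFun F G g
  map_add' η θ := by
    funext X Y p
    simp only [natDiffFun, Pi.add_apply, Tw.μ₁_add, Tw.μ₂_add_left, Tw.μ₂_add_right, smul_add,
      List.sum_map_add]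
    abel
  map_smul' r η := by
    funext X Y p
    simp only [natDiffFun, Pi.smul_apply, Tw.μ₁_smul, Tw.μ₂_smul_left, Tw.μ₂_smul_right,
      RingHom.id_apply, Units.smul_def, smul_comm _ r, Tw.list_sum_smul,
      smul_add, smul_sub]

/-- The `A∞`-natural transformations `F ⇒ G` of degree `g`: the pre-natural transformations `η` of
degree `g` with `μ¹(η) = 0`. -/
def natTrans (F G : AInfFunctor k C) (g : ℤ) : Submodule k (Family F G) :=
  preNat F G g ⊓ LinearMap.ker (natDiff F G g)

/-- The coboundaries of degree `g`: the differentials of pre-natural transformations of degree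
`g - 1`. -/
def coboundaries (F G : AInfFunctor k C) (g : ℤ) : Submodule k (Family F G) :=
  (preNat F G (g - 1)).map (natDiff F G (g - 1))

/-- The cohomology of the complex of pre-natural transformations `F ⇒ G` in degree `g`. If `F` is
the inclusion of `C` this is the Hochschild cohomology `HH^g(G)`. -/
abbrev HH (F G : AInfFunctor k C) (g : ℤ) : Type _ :=
  natTrans F G g ⧸ (coboundaries F G g).submoduleOf (natTrans F G g)

/-- The components of the inclusion `C → Tw C`. -/
def inclMap : ∀ {X Y : C}, Quiver.Path X Y → Tw.Hom (Tw.single X) (Tw.single Y)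
  | _, _, .nil => 0
  | _, _, .cons .nil f => fun _ _ => f
  | _, _, .cons (.cons _ _) _ => 0

theorem inclMap_eq_zero {X Y : C} (p : Quiver.Path X Y) (h : p.length ≠ 1) : inclMap p = 0 := by
  match p, h with
  | .nil, _ => rfl
  | .cons .nil f, h => simp at h
  | .cons (.cons _ _) _, _ => rfl

variable (k C) in
/-- The inclusion `C → Tw C`, that is, the restriction to `C` of the identity functor of `Tw C`. Its
only component is `F^1(a) = a`. -/
def incl : AInfFunctor k C where
  obj := Tw.single
  map := inclMap
  map_nil _ := rfl
  map_linear {X Y Z W} p q := by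
    by_cases h : ((p.cons (0 : Y ⟶ Z)).comp q).length = 1
    · match p, q with
      | .nil, .nil => exact ⟨fun f g => rfl, fun c f => rfl⟩
      | .cons _ _, _ => simp at h; omega
      | _, .cons _ _ => simp at h
    · have : ∀ f : Y ⟶ Z, inclMap ((p.cons f).comp q) = 0 := fun f =>
        inclMap_eq_zero _ (by simpa using h)
      simp only [this]
      exact ⟨by simp, by simp⟩
  map_deg {X Y} p := by
    match p with
    | .nil => intro a b _; rfl
    | .cons .nil f => intro a b h; simp [Tw.single] at h
    | .cons (.cons _ _) _ => intro a b _; rfl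
  map_rel {X Y} p := by
    have hμ : ∀ {X Y : C} (φ : Tw.Hom (Tw.single X) (Tw.single Y)), Tw.μ₁ φ = 0 := by
      intro X Y φ; funext a c; simp [Tw.μ₁]
    rw [hμ, zero_add]
    match p with
    | .nil => simp [splits, contractions, inclMap]
    | .cons .nil f =>
      have h0 : ∀ Z : C, inclMap (.nil : Quiver.Path Z Z) = 0 := fun _ => rfl
      simp [splits, contractions, h0]
    | .cons (.cons .nil f) g =>
      have h0 : ∀ Z : C, inclMap (.nil : Quiver.Path Z Z) = 0 := fun _ => rfl
      simp only [splits, contractions, h0, List.map_cons, List.map_nil, List.nil_append,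
        List.cons_append, List.sum_cons, List.sum_nil, Tw.μ₂_zero_left, Tw.μ₂_zero_right,
        add_zero, zero_add, Quiver.Path.length_nil, Nat.cast_zero, neg_zero,
        Int.negOnePow_zero, one_smul]
      funext a c
      simp only [Tw.μ₂, Tw.single_sum, Tw.single_deg, sub_zero, Int.negOnePow_zero, one_smul]
      rfl
    | .cons (.cons (.cons p f) g) h =>
      rw [List.sum_eq_zero, List.sum_eq_zero]
      · intro x hx
        obtain ⟨c, hc, rfl⟩ := List.mem_map.1 hx
        have := length_of_mem_contractions _ c hc
        simp only [Quiver.Path.length_cons] at this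
        rw [inclMap_eq_zero _ (by omega), smul_zero]
      · intro x hx
        obtain ⟨s, hs, rfl⟩ := List.mem_map.1 hx
        have := length_of_mem_splits _ s hs
        simp only [Quiver.Path.length_cons] at this
        by_cases h1 : s.2.1.length = 1
        · rw [inclMap_eq_zero s.2.2 (by omega), Tw.μ₂_zero_left]
        · rw [inclMap_eq_zero s.2.1 h1, Tw.μ₂_zero_right]

end Functors

/-! ### The category of the generators `T_0, …, T_n` -/

/-- The objects `T_0, …, T_n` attached to `n` punctures. -/
structure KLRW (k : Type u) (n : ℕ) where
  idx : Fin (n + 1)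

/-- The exponent `δ(x, y, z)` in `a_{zy}s^β · a_{yx}s^α = a_{zx}s^{α + β + δ(x, y, z)}`. -/
def crossing (x y z : ℤ) : ℕ :=
  if 0 ≤ (x - y) * (y - z) then 0 else min (x - y).natAbs (y - z).natAbs

theorem crossing_eq (x y z : ℤ) :
    2 * (crossing x y z : ℤ) = |x - y| + |y - z| - |x - z| := by
  unfold crossing
  split_ifs with h
  · rcases mul_nonneg_iff.1 h with ⟨h1, h2⟩ | ⟨h1, h2⟩
    · rw [abs_of_nonneg h1, abs_of_nonneg h2, abs_of_nonneg (by omega)]; push_cast; omega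
    · rw [abs_of_nonpos h1, abs_of_nonpos h2, abs_of_nonpos (by omega)]; push_cast; omega
  · have h3 := abs_eq_max_neg (a := x - y)
    have h4 := abs_eq_max_neg (a := y - z)
    have h5 := abs_eq_max_neg (a := x - z)
    rcases mul_neg_iff.1 (not_le.1 h) with ⟨h1, h2⟩ | ⟨h1, h2⟩ <;> omega

namespace KLRW

variable {k : Type u} {n : ℕ}

/-- The index `j` of `T_j`, as an integer. -/
def pos (Y : KLRW k n) : ℤ := ((Y.idx : ℕ) : ℤ)

variable [Field k]

/-- `Hom(T_i, T_j) = ⨁_α k a_{ji}s^α`, where `a_{ji}s^α` is the monomial `X^α` of `k[X]`. -/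
noncomputable instance : Category.{u} (KLRW k n) where
  Hom _ _ := k[X]
  id _ := (1 : k[X])
  comp {T U V} f g := (f * g * X ^ crossing T.pos U.pos V.pos : k[X])
  id_comp {T U} f := by
    have h := crossing_eq T.pos T.pos U.pos
    have h' : crossing T.pos T.pos U.pos = 0 := by simp at h; exact h
    simp [h']
  comp_id {T U} f := by
    have h := crossing_eq T.pos U.pos U.pos
    have h' : crossing T.pos U.pos U.pos = 0 := by simp at h; exact h
    simp [h']
  assoc {T U V W} f g h := by
    have h1 := crossing_eq T.pos U.pos V.pos
    have h2 := crossing_eq T.pos V.pos W.pos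
    have h3 := crossing_eq U.pos V.pos W.pos
    have h4 := crossing_eq T.pos U.pos W.pos
    have e : crossing T.pos U.pos V.pos + crossing T.pos V.pos W.pos
        = crossing U.pos V.pos W.pos + crossing T.pos U.pos W.pos := by omega
    calc f * g * X ^ crossing T.pos U.pos V.pos * h * X ^ crossing T.pos V.pos W.pos
        = f * g * h * X ^ (crossing T.pos U.pos V.pos + crossing T.pos V.pos W.pos) := by
          rw [pow_add]; ring
      _ = f * (g * h * X ^ crossing U.pos V.pos W.pos) * X ^ crossing T.pos U.pos W.pos := by
          rw [e, pow_add]; ring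

noncomputable instance : Preadditive (KLRW k n) where
  homGroup _ _ := inferInstanceAs (AddCommGroup k[X])
  add_comp T U V f f' g := by
    have h : ∀ (a b c d : k[X]), (a + b) * c * d = a * c * d + b * c * d := fun _ _ _ _ => by ring
    exact h f f' g _
  comp_add T U V f g g' := by
    have h : ∀ (a b c d : k[X]), a * (b + c) * d = a * b * d + a * c * d := fun _ _ _ _ => by ring
    exact h f g g' _

noncomputable instance : Linear k (KLRW k n) where
  homModule _ _ := inferInstanceAs (Module k k[X])
  smul_comp T U V r f g := by
    have h : ∀ (a b c : k[X]), (r • a) * b * c = r • (a * b * c) := fun _ _ _ => by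
      simp only [smul_mul_assoc]
    exact h f g _
  comp_smul T U V f r g := by
    have h : ∀ (a b c : k[X]), a * (r • b) * c = r • (a * b * c) := fun _ _ _ => by
      simp only [smul_mul_assoc, mul_smul_comm]
    exact h f g _

end KLRW

/-! ### The negative braiding functor

The functor exchanges the punctures number `i` and `i + 1`, where `0 < i < n`. The object `T_j` is
left unchanged for `j ≠ i`, and `T_i` goes to `T_i ⟶ T_{i-1} ⊕ T_{i+1}`. -/

/-- Labels for the summands of `β T_j`. The summand `main` is `T_j`; the summands `left` and `right`
are `T_{i-1}` and `T_{i+1}`, and are present for `j = i` only. -/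
inductive Slot
  | main
  | left
  | right
  deriving DecidableEq

instance : Fintype Slot := ⟨{.main, .left, .right}, by rintro (_ | _ | _) <;> simp⟩

section Braiding

variable {k : Type u} [Field k] {n : ℕ} (i : ℕ)

/-- The position of a summand of `β T_j`. -/
def slotPos (j : ℤ) : Slot → ℤ
  | .main => j
  | .left => i - 1
  | .right => i + 1

/-- The degree of a summand of `β T_j`. -/
def slotDeg (j : ℤ) : Slot → ℤ
  | .main => if j = i then -1 else 0
  | _ => 0

/-- The bounding cochain `(a_{i-1,i}, -a_{i+1,i}) : T_i ⟶ T_{i-1} ⊕ T_{i+1}`. -/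
noncomputable def slotδ : Slot → Slot → k[X]
  | .main, .left => 1
  | .main, .right => -1
  | _, _ => 0

/-- The action `β^1` on the morphism `a_{lj} f(s)` from `T_j` to `T_l`. -/
noncomputable def braid₁ (j l : ℤ) (f : k[X]) : Slot → Slot → k[X] :=
  if j ≠ i then
    if l ≠ i then
      fun
        | .main, .main => f
        | _, _ => 0
    else
      fun
        | .main, .left => if j < i then f else 0
        | .main, .right => if i < j then f else 0
        | _, _ => 0
  else
    if l ≠ i then
      fun
        | .left, .main => if i < l then f else f * X
        | .right, .main => if i < l then f * X else f
        | _, _ => 0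
    else
      fun s t => if s = t then f else 0

/-- The component `β^2` on the morphisms `a_{ml} g(s)` and `a_{lj} f(s)`. -/
noncomputable def braid₂ (j l m : ℤ) (g f : k[X]) : Slot → Slot → k[X] :=
  if m ≠ i then fun _ _ => 0
  else
    if j ≠ i then
      fun
        | .main, .main =>
            if (i - j) * (i - l) < 0 then
              (i - l : ℤ).sign • (g * f * X ^ ((i - l : ℤ).natAbs - 1))
            else 0
        | _, _ => 0
    else
      fun
        | .left, .main =>
            if i < l then (i - l : ℤ).sign • (g * f * X ^ ((i - l : ℤ).natAbs - 1)) else 0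
        | .right, .main =>
            if l < i then (i - l : ℤ).sign • (g * f * X ^ ((i - l : ℤ).natAbs - 1)) else 0
        | _, _ => 0

variable {i} (hi : 0 < i) (hn : i < n)

/-- The twisted complex `β T_j`. -/
noncomputable def braidObj (Y : KLRW k n) : Tw (KLRW k n) where
  ι := {s : Slot // s = .main ∨ Y.pos = i}
  obj s := match s.1 with
    | .main => Y
    | .left => ⟨⟨i - 1, by omega⟩⟩
    | .right => ⟨⟨i + 1, by omega⟩⟩
  deg s := slotDeg i Y.pos s.1
  δ s t := (slotδ s.1 t.1 : k[X])
  δ_deg := by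
    rintro ⟨s, hs⟩ ⟨t, ht⟩ h
    have : (slotδ s t : k[X]) = 0 := by
      cases s <;> cases t <;> simp_all [slotδ, slotDeg] <;> split_ifs at h <;> simp_all
    exact this
  δ_sq := by
    rintro ⟨s, hs⟩ ⟨u, hu⟩
    refine Finset.sum_eq_zero ?_
    rintro ⟨t, ht⟩ -
    have : (slotδ s t * slotδ t u : k[X]) = 0 := by
      cases s <;> cases t <;> cases u <;> simp [slotδ]
    change (slotδ s t * slotδ t u * _ : k[X]) = 0
    rw [this, zero_mul]

/-- The morphism `β Y ⟶ β Z` with the given matrix entries. -/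
noncomputable def slotHom (Y Z : KLRW k n) (Φ : Slot → Slot → k[X]) :
    Tw.Hom (braidObj hi hn Y) (braidObj hi hn Z) :=
  fun s t => (Φ s.1 t.1 : k[X])

/-- The components of the negative braiding functor. -/
noncomputable def braidMap : ∀ {Y Z : KLRW k n}, Quiver.Path Y Z →
    Tw.Hom (braidObj hi hn Y) (braidObj hi hn Z)
  | _, _, .nil => 0
  | Y, Z, .cons .nil f => slotHom hi hn Y Z (braid₁ i Y.pos Z.pos f)
  | Y, Z, .cons (.cons (c := U) .nil f) g =>
      slotHom hi hn Y Z (braid₂ i Y.pos U.pos Z.pos g f)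
  | _, _, .cons (.cons (.cons _ _) _) _ => 0

variable (i) in
/-- The product `μ²` in terms of the summands. -/
noncomputable def slotμ₂ (x y z : ℤ) (ψ φ : Slot → Slot → k[X]) (s t : Slot) : k[X] :=
  let term (r : Slot) : k[X] := (slotDeg i y r - slotDeg i x s).negOnePow •
    (φ s r * ψ r t * X ^ crossing (slotPos i x s) (slotPos i y r) (slotPos i z t))
  term .main + if y = i then term .left + term .right else 0

variable (i) in
/-- The second part `φ δ` of the differential `μ¹` in terms of the summands. -/
noncomputable def slotμ₁' (x y : ℤ) (φ : Slot → Slot → k[X]) (s t : Slot) : k[X] :=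
  let term (r : Slot) : k[X] :=
    slotδ s r * φ r t * X ^ crossing (slotPos i x s) (slotPos i x r) (slotPos i y t)
  term .main + if x = i then term .left + term .right else 0

variable (i) in
/-- The differential `μ¹` in terms of the summands. -/
noncomputable def slotμ₁ (x y : ℤ) (φ : Slot → Slot → k[X]) (s t : Slot) : k[X] :=
  slotμ₂ i x y y slotδ φ s t - slotμ₁' i x y φ s t

/-! The equations for the functor are checked after the substitution `X = u²` and a rescaling of
`a_{ji}` by `u ^ |i - j|`, which turns the composition into the product. -/

variable (k) in
/-- The square root `u` of the variable. -/
noncomputable def root : FractionRing k[X] := algebraMap k[X] _ X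

theorem root_ne_zero : root k ≠ 0 := by
  simp [root]

/-- The rescaled morphism. -/
noncomputable def gauge (a b : ℤ) (f : k[X]) : FractionRing k[X] :=
  algebraMap k[X] _ (expand k 2 f) * root k ^ |a - b|

theorem gauge_def (a b : ℤ) (f : k[X]) :
    gauge a b f = algebraMap k[X] _ (expand k 2 f) * root k ^ |a - b| := rfl

theorem gauge_injective (a b : ℤ) {f g : k[X]} (h : gauge a b f = gauge a b g) : f = g := by
  have h' := mul_right_cancel₀ (zpow_ne_zero _ root_ne_zero) h
  exact expand_injective (by norm_num) (IsFractionRing.injective k[X] (FractionRing k[X]) h')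

@[simp] theorem gauge_zero (a b : ℤ) : gauge a b (0 : k[X]) = 0 := by simp [gauge]

@[simp] theorem gauge_neg (a b : ℤ) (f : k[X]) : gauge a b (-f) = -gauge a b f := by simp [gauge]

@[simp] theorem gauge_add (a b : ℤ) (f g : k[X]) :
    gauge a b (f + g) = gauge a b f + gauge a b g := by simp [gauge, add_mul]

@[simp] theorem gauge_sub (a b : ℤ) (f g : k[X]) :
    gauge a b (f - g) = gauge a b f - gauge a b g := by simp [gauge, sub_mul]

@[simp] theorem gauge_units_smul (a b : ℤ) (r : ℤˣ) (f : k[X]) :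
    gauge a b (r • f) = r • gauge a b f := by
  rcases Int.units_eq_one_or r with rfl | rfl <;> simp [Units.smul_def]

theorem gauge_comp (a b c : ℤ) (f g : k[X]) :
    gauge a c (f * g * X ^ crossing a b c) = gauge a b f * gauge b c g := by
  have h : root k ^ (2 * (crossing a b c : ℤ)) * root k ^ |a - c|
      = root k ^ |a - b| * root k ^ |b - c| := by
    rw [crossing_eq, ← zpow_add₀ root_ne_zero, ← zpow_add₀ root_ne_zero]
    congr 1; ring
  have h2 : algebraMap k[X] (FractionRing k[X]) (expand k 2 (X ^ crossing a b c))
      = root k ^ (2 * (crossing a b c : ℤ)) := by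
    rw [map_pow, expand_X, map_pow, map_pow, zpow_mul, zpow_natCast]; rfl
  unfold gauge
  rw [map_mul, map_mul, map_mul, map_mul, h2]
  linear_combination (algebraMap k[X] (FractionRing k[X]) (expand k 2 f)
    * algebraMap k[X] (FractionRing k[X]) (expand k 2 g)) * h

theorem gauge_shift {a b c d : ℤ} (m : ℕ) (f : k[X]) :
    gauge a b (f * X ^ m) = root k ^ (2 * (m : ℤ) + |a - b| - |c - d|) * gauge c d f := by
  have h2 : algebraMap k[X] (FractionRing k[X]) (expand k 2 (X ^ m))
      = root k ^ (2 * (m : ℤ)) := by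
    rw [map_pow, expand_X, map_pow, map_pow, zpow_mul, zpow_natCast]; rfl
  have h : root k ^ (2 * (m : ℤ)) * root k ^ |a - b|
      = root k ^ (2 * (m : ℤ) + |a - b| - |c - d|) * root k ^ |c - d| := by
    rw [← zpow_add₀ root_ne_zero, ← zpow_add₀ root_ne_zero]
    congr 1; ring
  unfold gauge
  rw [map_mul, map_mul, h2]
  linear_combination (algebraMap k[X] (FractionRing k[X]) (expand k 2 f)) * h

theorem gauge_shift₂ {a b c d e : ℤ} (m : ℕ) (g f : k[X]) :
    gauge a b (g * f * X ^ m)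
      = root k ^ (2 * (m : ℤ) + |a - b| - |c - d| - |d - e|) * (gauge c d f * gauge d e g) := by
  have h2 : algebraMap k[X] (FractionRing k[X]) (expand k 2 (X ^ m))
      = root k ^ (2 * (m : ℤ)) := by
    rw [map_pow, expand_X, map_pow, map_pow, zpow_mul, zpow_natCast]; rfl
  have h : root k ^ (2 * (m : ℤ)) * root k ^ |a - b|
      = root k ^ (2 * (m : ℤ) + |a - b| - |c - d| - |d - e|)
        * (root k ^ |c - d| * root k ^ |d - e|) := by
    rw [← zpow_add₀ root_ne_zero, ← zpow_add₀ root_ne_zero, ← zpow_add₀ root_ne_zero]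
    congr 1; ring
  unfold gauge
  rw [map_mul, map_mul, map_mul, map_mul, h2]
  linear_combination (algebraMap k[X] (FractionRing k[X]) (expand k 2 f)
    * algebraMap k[X] (FractionRing k[X]) (expand k 2 g)) * h

attribute [irreducible] gauge

theorem gauge_slotμ₂ (x y z : ℤ) (ψ φ : Slot → Slot → k[X]) (s t : Slot) :
    gauge (slotPos i x s) (slotPos i z t) (slotμ₂ i x y z ψ φ s t) =
      (slotDeg i y .main - slotDeg i x s).negOnePow •
        (gauge (slotPos i x s) (slotPos i y .main) (φ s .main)
          * gauge (slotPos i y .main) (slotPos i z t) (ψ .main t)) +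
      if y = i then
        (slotDeg i y .left - slotDeg i x s).negOnePow •
          (gauge (slotPos i x s) (slotPos i y .left) (φ s .left)
            * gauge (slotPos i y .left) (slotPos i z t) (ψ .left t)) +
        (slotDeg i y .right - slotDeg i x s).negOnePow •
          (gauge (slotPos i x s) (slotPos i y .right) (φ s .right)
            * gauge (slotPos i y .right) (slotPos i z t) (ψ .right t))
      else 0 := by
  unfold slotμ₂
  split_ifs <;> simp only [gauge_add, gauge_units_smul, gauge_comp, gauge_zero]

theorem gauge_slotμ₁' (x y : ℤ) (φ : Slot → Slot → k[X]) (s t : Slot) :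
    gauge (slotPos i x s) (slotPos i y t) (slotμ₁' i x y φ s t) =
      gauge (slotPos i x s) (slotPos i x .main) (slotδ s .main)
          * gauge (slotPos i x .main) (slotPos i y t) (φ .main t) +
      if x = i then
        gauge (slotPos i x s) (slotPos i x .left) (slotδ s .left)
            * gauge (slotPos i x .left) (slotPos i y t) (φ .left t) +
        gauge (slotPos i x s) (slotPos i x .right) (slotδ s .right)
            * gauge (slotPos i x .right) (slotPos i y t) (φ .right t)
      else 0 := by
  unfold slotμ₁'
  split_ifs <;> simp only [gauge_add, gauge_comp, gauge_zero]

variable (k i) in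
/-- The rescaled matrix of `β^1`. -/
noncomputable def gauge₁ (j l : ℤ) : Slot → Slot → FractionRing k[X] :=
  if j ≠ i then
    if l ≠ i then
      fun
        | .main, .main => 1
        | _, _ => 0
    else
      fun
        | .main, .left => if j < i then (root k)⁻¹ else 0
        | .main, .right => if i < j then (root k)⁻¹ else 0
        | _, _ => 0
  else
    if l ≠ i then
      fun
        | .left, .main => root k
        | .right, .main => root k
        | _, _ => 0
    else
      fun s t => if s = t then 1 else 0

variable (k i) in
/-- The rescaled matrix of `β^2`. -/
noncomputable def gauge₂ (j l m : ℤ) : Slot → Slot → FractionRing k[X] :=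
  if m ≠ i then fun _ _ => 0
  else
    if j ≠ i then
      fun
        | .main, .main =>
            if j < i ∧ i < l then -((root k)⁻¹ * (root k)⁻¹)
            else if i < j ∧ l < i then (root k)⁻¹ * (root k)⁻¹ else 0
        | _, _ => 0
    else
      fun
        | .left, .main => if i < l then -(root k)⁻¹ else 0
        | .right, .main => if l < i then (root k)⁻¹ else 0
        | _, _ => 0

theorem gauge_slotδ (j : ℤ) (s t : Slot) (hs : s = .main ∨ j = i) (ht : t = .main ∨ j = i) :
    gauge (slotPos i j s) (slotPos i j t) (slotδ s t : k[X]) =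
      match s, t with
      | .main, .left => root k
      | .main, .right => -root k
      | _, _ => 0 := by
  cases s <;> cases t <;> simp [slotδ, slotPos, gauge_def] <;> simp_all

theorem gauge_eq₀ {a b c d : ℤ} (f : k[X]) (e : ℤ) (h : |a - b| - |c - d| = e) :
    gauge a b f = root k ^ e * gauge c d f := by
  have := gauge_shift (a := a) (b := b) (c := c) (d := d) 0 f
  rw [pow_zero, mul_one] at this
  rw [this, ← h]; simp

theorem gauge_eq₁ {a b c d : ℤ} (f : k[X]) (e : ℤ) (h : 2 + |a - b| - |c - d| = e) :
    gauge a b (f * X) = root k ^ e * gauge c d f := by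
  have := gauge_shift (a := a) (b := b) (c := c) (d := d) 1 f
  rw [pow_one] at this
  rw [this, ← h]; simp

theorem gauge_eq₂ {a b c d e : ℤ} (m : ℕ) (g f : k[X]) (r : ℤ)
    (h : 2 * (m : ℤ) + |a - b| - |c - d| - |d - e| = r) :
    gauge a b (g * f * X ^ m) = root k ^ r * (gauge c d f * gauge d e g) := by
  rw [gauge_shift₂ (c := c) (d := d) (e := e), h]

theorem root_inv : (root k)⁻¹ = root k ^ (-1 : ℤ) := by simp

theorem root_one : root k = root k ^ (1 : ℤ) := by simp

theorem root_inv_inv : (root k)⁻¹ * (root k)⁻¹ = root k ^ (-2 : ℤ) := by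
  rw [show (-2 : ℤ) = -1 + -1 by norm_num, zpow_add₀ root_ne_zero]; simp

theorem vertex_cases (x y : ℤ) :
    (x < y ∧ x ≠ y ∧ ¬ y < x) ∨ x = y ∨ (y < x ∧ x ≠ y ∧ ¬ x < y) := by omega

theorem slot_cases {x : ℤ} {s : Slot} (hs : s = .main ∨ x = i) :
    (x < i ∧ x ≠ i ∧ ¬ i < x ∧ s = .main) ∨ (x = i ∧ s = .main) ∨ (x = i ∧ s = .left) ∨
      (x = i ∧ s = .right) ∨ (i < x ∧ x ≠ i ∧ ¬ x < i ∧ s = .main) := by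
  rcases vertex_cases x i with h | h | h <;> cases s <;> simp_all

set_option maxHeartbeats 1000000 in
theorem gauge_braid₁ (j l : ℤ) (f : k[X]) (s t : Slot) (hs : s = .main ∨ j = i)
    (ht : t = .main ∨ l = i) :
    gauge (slotPos i j s) (slotPos i l t) (braid₁ i j l f s t)
      = gauge₁ k i j l s t * gauge j l f := by
  unfold braid₁ gauge₁
  rcases slot_cases hs with ⟨x1, x2, x3, rfl⟩ | ⟨rfl, rfl⟩ | ⟨rfl, rfl⟩ | ⟨rfl, rfl⟩ |
    ⟨x1, x2, x3, rfl⟩ <;>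
  rcases slot_cases ht with ⟨y1, y2, y3, rfl⟩ | ⟨rfl, rfl⟩ | ⟨rfl, rfl⟩ | ⟨rfl, rfl⟩ |
    ⟨y1, y2, y3, rfl⟩ <;>
  first
  | (simp [slotPos, *]; done)
  | (simp only [slotPos, ne_eq, not_true_eq_false, not_false_eq_true, if_true, if_false, *]
     first
     | rw [root_inv]
     | skip
     first
     | (with_reducible refine gauge_eq₀ f _ ?_
        simp only [abs_eq_max_neg]; omega)
     | (simp only [gauge_def, sub_self, abs_zero, one_mul]; done)
     | (refine Eq.trans ?_ (congrArg (· * _) root_one.symm)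
        first
        | (with_reducible refine gauge_eq₁ f _ ?_
           simp only [abs_eq_max_neg]; omega)
        | (with_reducible refine gauge_eq₀ f _ ?_
           simp only [abs_eq_max_neg]; omega)))

set_option maxHeartbeats 1000000 in
theorem gauge_braid₂ (j l m : ℤ) (g f : k[X]) (s t : Slot) (hs : s = .main ∨ j = i)
    (ht : t = .main ∨ m = i) :
    gauge (slotPos i j s) (slotPos i m t) (braid₂ i j l m g f s t)
      = gauge₂ k i j l m s t * (gauge j l f * gauge l m g) := by
  unfold braid₂ gauge₂
  rcases slot_cases hs with ⟨x1, x2, x3, rfl⟩ | ⟨rfl, rfl⟩ | ⟨rfl, rfl⟩ | ⟨rfl, rfl⟩ |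
    ⟨x1, x2, x3, rfl⟩ <;>
  rcases vertex_cases l i with ⟨y1, y2, y3⟩ | rfl | ⟨y1, y2, y3⟩ <;>
  rcases slot_cases ht with ⟨z1, z2, z3, rfl⟩ | ⟨rfl, rfl⟩ | ⟨rfl, rfl⟩ | ⟨rfl, rfl⟩ |
    ⟨z1, z2, z3, rfl⟩ <;>
  first
  | (simp [slotPos, mul_neg_iff, *]; done)
  | (have hsg : ((i : ℤ) - l).sign = 1 := Int.sign_eq_one_of_pos (by omega)
     simp only [slotPos, ne_eq, not_true_eq_false, not_false_eq_true, if_true, if_false,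
      mul_neg_iff, sub_pos, sub_neg, and_true, true_and, and_false, false_and, or_false, false_or,
      one_smul, and_self, root_inv_inv, *]
     first
     | (with_reducible refine gauge_eq₂ _ _ _ _ ?_
        simp only [abs_eq_max_neg]; omega)
     | (rw [root_inv]
        with_reducible refine gauge_eq₂ _ _ _ _ ?_
        simp only [abs_eq_max_neg]; omega))
  | (have hsg : ((i : ℤ) - l).sign = -1 := Int.sign_eq_neg_one_of_neg (by omega)
     simp only [slotPos, ne_eq, not_true_eq_false, not_false_eq_true, if_true, if_false,
      mul_neg_iff, sub_pos, sub_neg, and_true, true_and, and_false, false_and, or_false, false_or,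
      neg_smul, one_smul, and_self, gauge_neg, neg_mul, root_inv_inv, *]
     first
     | (with_reducible refine congrArg _ (gauge_eq₂ _ _ _ _ ?_)
        simp only [abs_eq_max_neg]; omega)
     | (rw [root_inv]
        with_reducible refine congrArg _ (gauge_eq₂ _ _ _ _ ?_)
        simp only [abs_eq_max_neg]; omega))

theorem braid_rel₁ (x y : ℤ) (f : k[X]) (s t : Slot) (hs : s = .main ∨ x = i)
    (ht : t = .main ∨ y = i) : slotμ₁ i x y (braid₁ i x y f) s t = 0 := by
  apply gauge_injective (slotPos i x s) (slotPos i y t)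
  unfold slotμ₁
  rw [gauge_sub, gauge_slotμ₂, gauge_slotμ₁']
  rcases slot_cases hs with ⟨x1, x2, x3, rfl⟩ | ⟨rfl, rfl⟩ | ⟨rfl, rfl⟩ | ⟨rfl, rfl⟩ |
    ⟨x1, x2, x3, rfl⟩ <;>
  rcases slot_cases ht with ⟨y1, y2, y3, rfl⟩ | ⟨rfl, rfl⟩ | ⟨rfl, rfl⟩ | ⟨rfl, rfl⟩ |
    ⟨y1, y2, y3, rfl⟩ <;>
  first
  | (simp [gauge_braid₁, gauge_slotδ, gauge₁, slotDeg, *]; done)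
  | (simp [gauge_braid₁, gauge_slotδ, gauge₁, slotDeg, *]; ring; done)

set_option maxHeartbeats 1000000 in
theorem braid_rel₂ (x y z : ℤ) (f g : k[X]) (s t : Slot) (hs : s = .main ∨ x = i)
    (ht : t = .main ∨ z = i) : slotμ₁ i x z (braid₂ i x y z g f) s t
      + slotμ₂ i x y z (braid₁ i y z g) (braid₁ i x y f) s t
      = braid₁ i x z (f * g * X ^ crossing x y z) s t := by
  apply gauge_injective (slotPos i x s) (slotPos i z t)
  have hz : root k ≠ 0 := root_ne_zero
  unfold slotμ₁
  rw [gauge_add, gauge_sub, gauge_slotμ₂, gauge_slotμ₂, gauge_slotμ₁', gauge_braid₁ x z _ s t hs ht,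
    gauge_comp]
  rcases slot_cases hs with ⟨x1, x2, x3, rfl⟩ | ⟨rfl, rfl⟩ | ⟨rfl, rfl⟩ | ⟨rfl, rfl⟩ |
    ⟨x1, x2, x3, rfl⟩ <;>
  rcases vertex_cases y i with ⟨y1, y2, y3⟩ | rfl | ⟨y1, y2, y3⟩ <;>
  rcases slot_cases ht with ⟨z1, z2, z3, rfl⟩ | ⟨rfl, rfl⟩ | ⟨rfl, rfl⟩ | ⟨rfl, rfl⟩ |
    ⟨z1, z2, z3, rfl⟩ <;>
  first
  | (simp [gauge_braid₁, gauge_braid₂, gauge_slotδ, gauge₁, gauge₂, slotDeg, *]; done)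
  | (simp [gauge_braid₁, gauge_braid₂, gauge_slotδ, gauge₁, gauge₂, slotDeg, *]; field_simp; done)
  | (simp [gauge_braid₁, gauge_braid₂, gauge_slotδ, gauge₁, gauge₂, slotDeg, *]; field_simp; ring; done)

set_option maxHeartbeats 4000000 in
theorem braid_rel₃ (x y z w : ℤ) (f g h : k[X]) (s t : Slot) (hs : s = .main ∨ x = i)
    (ht : t = .main ∨ w = i) :
    slotμ₂ i x y w (braid₂ i y z w h g) (braid₁ i x y f) s t
      + slotμ₂ i x z w (braid₁ i z w h) (braid₂ i x y z g f) s t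
      = braid₂ i x z w h (f * g * X ^ crossing x y z) s t
        - braid₂ i x y w (g * h * X ^ crossing y z w) f s t := by
  apply gauge_injective (slotPos i x s) (slotPos i w t)
  have hz : root k ≠ 0 := root_ne_zero
  rw [gauge_add, gauge_sub, gauge_slotμ₂, gauge_slotμ₂, gauge_braid₂ x z w _ _ s t hs ht,
    gauge_braid₂ x y w _ _ s t hs ht, gauge_comp, gauge_comp]
  rcases slot_cases hs with ⟨x1, x2, x3, rfl⟩ | ⟨rfl, rfl⟩ | ⟨rfl, rfl⟩ | ⟨rfl, rfl⟩ |
    ⟨x1, x2, x3, rfl⟩ <;>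
  rcases vertex_cases y i with ⟨y1, y2, y3⟩ | rfl | ⟨y1, y2, y3⟩ <;>
  rcases vertex_cases z i with ⟨z1, z2, z3⟩ | rfl | ⟨z1, z2, z3⟩ <;>
  rcases slot_cases ht with ⟨w1, w2, w3, rfl⟩ | ⟨rfl, rfl⟩ | ⟨rfl, rfl⟩ | ⟨rfl, rfl⟩ |
    ⟨w1, w2, w3, rfl⟩ <;>
  first
  | (simp [gauge_braid₁, gauge_braid₂, gauge₁, gauge₂, slotDeg, *]; done)
  | (simp [gauge_braid₁, gauge_braid₂, gauge₁, gauge₂, slotDeg, *]; field_simp; done)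
  | (simp [gauge_braid₁, gauge_braid₂, gauge₁, gauge₂, slotDeg, *]; field_simp; ring; done)

theorem braid_rel₄ (x y z w v : ℤ) (f g h e : k[X]) (s t : Slot) :
    slotμ₂ i x z v (braid₂ i z w v e h) (braid₂ i x y z g f) s t = 0 := by
  have h1 : ∀ r, r ≠ .main → braid₂ i x y z g f s r = 0 := by
    intro r hr
    unfold braid₂
    split_ifs <;> cases r <;> cases s <;> first | rfl | exact absurd rfl hr
  have h2 : z = i → braid₂ i z w v e h .main t = 0 := by
    rintro rfl
    unfold braid₂
    split_ifs <;> cases t <;> first | rfl | simp_all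
  have h3 : z ≠ i → braid₂ i x y z g f s .main = 0 := by
    intro hz
    simp [braid₂, hz]
  simp only [slotμ₂]
  rw [h1 .left (by simp), h1 .right (by simp)]
  by_cases hz : z = i
  · rw [h2 hz]; simp
  · rw [h3 hz]; simp

theorem braidObj_pos (Y : KLRW k n) (s : (braidObj hi hn Y).ι) :
    ((braidObj hi hn Y).obj s).pos = slotPos i Y.pos s.1 := by
  obtain ⟨s, hs⟩ := s
  cases s with
  | main => rfl
  | left => simp only [braidObj, KLRW.pos, slotPos]; omega
  | right => simp only [braidObj, KLRW.pos, slotPos]; omega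

theorem slot_sum {M : Type*} [AddCommMonoid M] (y : ℤ) (F : Slot → M) :
    ∑ b : {s : Slot // s = .main ∨ y = i}, F b.1
      = F .main + if y = i then F .left + F .right else 0 := by
  have h : ∑ b : {s : Slot // s = .main ∨ y = i}, F b.1
      = ∑ s ∈ Finset.univ.filter (fun s : Slot => s = .main ∨ y = i), F s :=
    (Finset.sum_subtype _ (by simp) F).symm
  rw [h, Finset.sum_filter]
  have hu : (Finset.univ : Finset Slot) = {.main, .left, .right} := rfl
  rw [hu, Finset.sum_insert (by simp), Finset.sum_insert (by simp), Finset.sum_singleton]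
  by_cases hy : y = i <;> simp [hy]

theorem μ₂_slotHom (Y Z W : KLRW k n) (Ψ Φ : Slot → Slot → k[X]) :
    Tw.μ₂ (slotHom hi hn Z W Ψ) (slotHom hi hn Y Z Φ)
      = slotHom hi hn Y W (slotμ₂ i Y.pos Z.pos W.pos Ψ Φ) := by
  funext a c
  refine Eq.trans (Finset.sum_congr rfl fun b _ => ?_) (slot_sum (i := i) Z.pos fun r =>
    (slotDeg i Z.pos r - slotDeg i Y.pos a.1).negOnePow • (Φ a.1 r * Ψ r c.1 *
      X ^ crossing (slotPos i Y.pos a.1) (slotPos i Z.pos r) (slotPos i W.pos c.1) : k[X]))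
  rw [← braidObj_pos hi hn Y a, ← braidObj_pos hi hn Z b, ← braidObj_pos hi hn W c]
  rfl

theorem μ₁_slotHom (Y Z : KLRW k n) (Φ : Slot → Slot → k[X]) :
    Tw.μ₁ (slotHom hi hn Y Z Φ) = slotHom hi hn Y Z (slotμ₁ i Y.pos Z.pos Φ) := by
  funext a c
  have h1 := congrFun (congrFun (μ₂_slotHom hi hn Y Z Z slotδ Φ) a) c
  have h2 : ∑ b, (braidObj hi hn Y).δ a b ≫ slotHom hi hn Y Z Φ b c
      = (slotμ₁' i Y.pos Z.pos Φ a.1 c.1 : k[X]) := by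
    refine Eq.trans (Finset.sum_congr rfl fun b _ => ?_) (slot_sum (i := i) Y.pos fun r =>
      (slotδ a.1 r * Φ r c.1 *
        X ^ crossing (slotPos i Y.pos a.1) (slotPos i Y.pos r) (slotPos i Z.pos c.1) : k[X]))
    rw [← braidObj_pos hi hn Y a, ← braidObj_pos hi hn Y b, ← braidObj_pos hi hn Z c]
    rfl
  exact congrArg₂ (fun p q : k[X] => p - q) h1 h2

theorem slotHom_congr (Y Z : KLRW k n) (Φ Ψ : Slot → Slot → k[X])
    (h : ∀ s t, (s = .main ∨ Y.pos = i) → (t = .main ∨ Z.pos = i) → Φ s t = Ψ s t) :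
    slotHom hi hn Y Z Φ = slotHom hi hn Y Z Ψ := by
  funext a c
  exact h a.1 c.1 a.2 c.2

theorem braidMap_eq_zero {Y Z : KLRW k n} (p : Quiver.Path Y Z)
    (h : p.length = 0 ∨ 3 ≤ p.length) : braidMap hi hn p = 0 := by
  match p, h with
  | .nil, _ => rfl
  | .cons .nil f, h => simp at h
  | .cons (.cons .nil f) g, h => simp at h
  | .cons (.cons (.cons _ _) _) _, _ => rfl

theorem braid₁_add (j l : ℤ) (f f' : k[X]) :
    braid₁ i j l (f + f') = braid₁ i j l f + braid₁ i j l f' := by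
  funext s t
  unfold braid₁
  split_ifs <;> cases s <;> cases t <;> simp [add_mul]

theorem braid₁_smul (j l : ℤ) (r : k) (f : k[X]) :
    braid₁ i j l (r • f) = r • braid₁ i j l f := by
  funext s t
  unfold braid₁
  split_ifs <;> cases s <;> cases t <;> simp

theorem braid₂_add_left (j l m : ℤ) (g g' f : k[X]) :
    braid₂ i j l m (g + g') f = braid₂ i j l m g f + braid₂ i j l m g' f := by
  funext s t
  unfold braid₂
  split_ifs <;> cases s <;> cases t <;> simp [add_mul]

theorem braid₂_add_right (j l m : ℤ) (g f f' : k[X]) :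
    braid₂ i j l m g (f + f') = braid₂ i j l m g f + braid₂ i j l m g f' := by
  funext s t
  unfold braid₂
  split_ifs <;> cases s <;> cases t <;> simp [add_mul, mul_add]

theorem braid₂_smul_left (j l m : ℤ) (r : k) (g f : k[X]) :
    braid₂ i j l m (r • g) f = r • braid₂ i j l m g f := by
  funext s t
  unfold braid₂
  split_ifs <;> cases s <;> cases t <;> simp

theorem braid₂_smul_right (j l m : ℤ) (r : k) (g f : k[X]) :
    braid₂ i j l m g (r • f) = r • braid₂ i j l m g f := by
  funext s t
  unfold braid₂
  split_ifs <;> cases s <;> cases t <;> simp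

/-- The negative braiding functor. -/
noncomputable def braidFunctor : AInfFunctor k (KLRW k n) where
  obj := braidObj hi hn
  map := braidMap hi hn
  map_nil _ := rfl
  map_linear {Y Z U W} p q := by
    match p, q with
    | .nil, .nil =>
      exact ⟨fun f f' => congrArg (slotHom hi hn Y U) (braid₁_add Y.pos U.pos f f'),
        fun r f => congrArg (slotHom hi hn Y U) (braid₁_smul Y.pos U.pos r f)⟩
    | .nil, .cons .nil g =>
      exact ⟨fun f f' => congrArg (slotHom hi hn Y W) (braid₂_add_right Y.pos U.pos W.pos g f f'),
        fun r f => congrArg (slotHom hi hn Y W) (braid₂_smul_right Y.pos U.pos W.pos r g f)⟩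
    | .cons .nil g, .nil =>
      exact ⟨fun f f' => congrArg (slotHom hi hn Y U) (braid₂_add_left Y.pos Z.pos U.pos f f' g),
        fun r f => congrArg (slotHom hi hn Y U) (braid₂_smul_left Y.pos Z.pos U.pos r f g)⟩
    | .cons (.cons p a) b, q =>
      have : ∀ f : Z ⟶ U, braidMap hi hn ((((p.cons a).cons b).cons f).comp q) = 0 :=
        fun f => braidMap_eq_zero hi hn _ (Or.inr (by simp; omega))
      simp only [this]
      exact ⟨by simp, by simp⟩
    | p, .cons (.cons q a) b =>
      have : ∀ f : Z ⟶ U, braidMap hi hn ((p.cons f).comp ((q.cons a).cons b)) = 0 :=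
        fun f => braidMap_eq_zero hi hn _ (Or.inr (by simp; omega))
      simp only [this]
      exact ⟨by simp, by simp⟩
    | .cons p a, .cons q b =>
      have : ∀ f : Z ⟶ U, braidMap hi hn (((p.cons a).cons f).comp (q.cons b)) = 0 :=
        fun f => braidMap_eq_zero hi hn _ (Or.inr (by simp; omega))
      simp only [this]
      exact ⟨by simp, by simp⟩
  map_deg {Y Z} p := by
    match p with
    | .nil => intro a b _; rfl
    | .cons .nil f =>
      rintro ⟨s, hs⟩ ⟨t, ht⟩ h
      have : braid₁ i Y.pos Z.pos f s t = 0 := by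
        by_contra h'
        refine h ?_
        simp only [braidObj, Quiver.Path.length_cons, Quiver.Path.length_nil]
        unfold braid₁ at h'
        split_ifs at h' <;> cases s <;> cases t <;> simp_all [slotDeg]
      exact this
    | .cons (.cons (c := U) .nil f) g =>
      rintro ⟨s, hs⟩ ⟨t, ht⟩ h
      have : braid₂ i Y.pos U.pos Z.pos g f s t = 0 := by
        by_contra h'
        refine h ?_
        simp only [braidObj, Quiver.Path.length_cons, Quiver.Path.length_nil]
        unfold braid₂ at h'
        split_ifs at h' <;> cases s <;> cases t <;> simp_all [slotDeg]
      exact this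
    | .cons (.cons (.cons _ _) _) _ => intro a b _; rfl
  map_rel {Y Z} p := by
    have h0 : ∀ U : KLRW k n, braidMap hi hn (.nil : Quiver.Path U U) = 0 := fun _ => rfl
    match p with
    | .nil => simp [splits, contractions, h0]
    | .cons .nil f =>
      simp only [splits, contractions, h0, List.map_cons, List.map_nil, List.nil_append,
        List.cons_append, List.sum_cons, List.sum_nil, Tw.μ₂_zero_left, Tw.μ₂_zero_right,
        add_zero]
      refine (μ₁_slotHom hi hn Y Z _).trans (slotHom_congr hi hn Y Z _ 0 ?_)
      exact fun s t hs ht => braid_rel₁ Y.pos Z.pos f s t hs ht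
    | .cons (.cons (c := U) .nil f) g =>
      simp only [splits, contractions, h0, List.map_cons, List.map_nil, List.nil_append,
        List.cons_append, List.sum_cons, List.sum_nil, Tw.μ₂_zero_left, Tw.μ₂_zero_right,
        add_zero, zero_add, Quiver.Path.length_nil, Nat.cast_zero, neg_zero,
        Int.negOnePow_zero, one_smul]
      refine (congrArg₂ (· + ·) (μ₁_slotHom hi hn Y Z _) (μ₂_slotHom hi hn Y U Z _ _)).trans ?_
      refine slotHom_congr hi hn Y Z (slotμ₁ i _ _ _ + slotμ₂ i _ _ _ _ _) _ ?_
      exact fun s t hs ht => braid_rel₂ Y.pos U.pos Z.pos f g s t hs ht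
    | .cons (.cons (c := V) (.cons (c := U) .nil f) g) h =>
      have hz : braidMap hi hn (((Quiver.Path.nil.cons f).cons g).cons h) = 0 := rfl
      simp only [splits, contractions, h0, List.map_cons, List.map_nil, List.nil_append,
        List.cons_append, List.sum_cons, List.sum_nil, Tw.μ₂_zero_left, Tw.μ₂_zero_right,
        add_zero, zero_add, Quiver.Path.length_nil, Quiver.Path.length_cons, Nat.cast_zero,
        neg_zero, Int.negOnePow_zero, one_smul, hz, Tw.μ₁_zero, Nat.cast_one, Int.negOnePow_neg,
        Int.negOnePow_one, Units.neg_smul]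
      refine (congrArg₂ (· + ·) (μ₂_slotHom hi hn Y U Z _ _) (μ₂_slotHom hi hn Y V Z _ _)).trans ?_
      refine Eq.trans (slotHom_congr hi hn Y Z
        (slotμ₂ i Y.pos U.pos Z.pos (braid₂ i U.pos V.pos Z.pos h g) (braid₁ i Y.pos U.pos f)
          + slotμ₂ i Y.pos V.pos Z.pos (braid₁ i V.pos Z.pos h) (braid₂ i Y.pos U.pos V.pos g f))
        (braid₂ i Y.pos V.pos Z.pos h (f ≫ g)
          - braid₂ i Y.pos U.pos Z.pos (g ≫ h) f) ?_) ?_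
      · exact fun s t hs ht => braid_rel₃ Y.pos U.pos V.pos Z.pos f g h s t hs ht
      · exact sub_eq_add_neg _ _
    | .cons (.cons (.cons (.cons p e) f) g) h =>
      have h4 : ∀ {U V : KLRW k n} (q : Quiver.Path U V),
          q.length = p.length + 3 ∨ q.length = p.length + 4 → braidMap hi hn q = 0 :=
        fun q hq => braidMap_eq_zero hi hn q (by omega)
      rw [h4 _ (Or.inr rfl), Tw.μ₁_zero, zero_add, List.sum_eq_zero, List.sum_eq_zero]
      · intro x hx
        obtain ⟨c, hc, rfl⟩ := List.mem_map.1 hx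
        have := length_of_mem_contractions _ c hc
        simp only [Quiver.Path.length_cons] at this
        rw [braidMap_eq_zero hi hn _ (by omega), smul_zero]
      · intro x hx
        obtain ⟨⟨W, q, r⟩, hs, rfl⟩ := List.mem_map.1 hx
        have := length_of_mem_splits _ _ hs
        simp only [Quiver.Path.length_cons] at this ⊢
        by_cases h1 : q.length = 0 ∨ 3 ≤ q.length
        · rw [braidMap_eq_zero hi hn q h1, Tw.μ₂_zero_right]
        by_cases h2 : r.length = 0 ∨ 3 ≤ r.length
        · rw [braidMap_eq_zero hi hn r h2, Tw.μ₂_zero_left]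
        have h5 : q.length = 2 := by omega
        have h6 : r.length = 2 := by omega
        clear hs hx this h1 h2
        match q, r, h5, h6 with
        | .cons (.cons (c := A) .nil a) b, .cons (.cons (c := B) .nil c) d, _, _ =>
          refine (μ₂_slotHom hi hn Y W Z _ _).trans (slotHom_congr hi hn Y Z _ 0 ?_)
          exact fun s t _ _ => braid_rel₄ Y.pos A.pos W.pos B.pos Z.pos a b c d s t
        | .nil, _, h5, _ => simp at h5
        | .cons .nil _, _, h5, _ => simp at h5
        | .cons (.cons (.cons _ _) _) _, _, h5, _ => simp at h5
        | _, .nil, _, h5 => simp at h5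
        | _, .cons .nil _, _, h5 => simp at h5
        | _, .cons (.cons (.cons _ _) _) _, _, h5 => simp at h5

/-- The component `η⁰(T_j)`: it is `∑ ε_ℓ s^ℓ` for `j ≠ i` and the pair of `∑ ½ ε_ℓ a_{i-1,i}s^{ℓ-1}`
and `∑ ½ ε_ℓ a_{i+1,i}s^{ℓ-1}` for `j = i`. -/
noncomputable def braidNat₀ (ε : ℕ+ →₀ k) (Y : KLRW k n) :
    Tw.Hom ((incl k (KLRW k n)).obj Y) ((braidFunctor hi hn).obj Y) := fun _ t =>
  match t.1 with
  | .main => if Y.pos = i then (0 : k[X]) else (ε.sum fun ℓ c => monomial (ℓ : ℕ) c : k[X])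
  | _ => (ε.sum fun ℓ c => monomial ((ℓ : ℕ) - 1) (c / 2) : k[X])

/-- The component `η¹` on a morphism `a_{kj}f(s)`: it vanishes for `k ≠ i`, and it is
`sgn(i - j) ∑ ½ ε_ℓ a_{ij}s^{ℓ-1}f(s)`, a morphism to the summand `T_i` of `β T_i`, for `k = i`. -/
noncomputable def braidNat₁ (ε : ℕ+ →₀ k) {Y Z : KLRW k n} (f : Y ⟶ Z) :
    Tw.Hom ((incl k (KLRW k n)).obj Y) ((braidFunctor hi hn).obj Z) := fun _ t =>
  match t.1 with
  | .main =>
      if Z.pos = i then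
        ((i - Y.pos : ℤ).sign • (ε.sum fun ℓ c => monomial ((ℓ : ℕ) - 1) (c / 2) * f : k[X]) : k[X])
      else (0 : k[X])
  | _ => (0 : k[X])

/-- The family `η` with components `η⁰`, `η¹` as above and `η^d = 0` for `d ≥ 2`. -/
noncomputable def braidNat (ε : ℕ+ →₀ k) : Family (incl k (KLRW k n)) (braidFunctor hi hn)
  | Y, _, .nil => braidNat₀ hi hn ε Y
  | _, _, .cons .nil f => braidNat₁ hi hn ε f
  | _, _, .cons (.cons _ _) _ => 0

end Braiding

end Braid

/-!
Put `s = u²` and multiply the entry of a morphism from `T_a` to `T_b` by `u^|a-b|`: composition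
becomes multiplication in `k(u)`, and the naturality equations become linear relations between the
rescaled components. For `η` of degree `0` with `η⁰(T_i) = (l, r)`, the equation for a single
morphism `f : T_j ⟶ T_i` has one component at `T_{i-1}` and one at `T_{i+1}`. For `j < i` the second
one gives `η¹(f) = r f`, for `j > i` the first one gives `η¹(f) = -l f`, and for `j = i` either one
gives `η¹(f) = 0`; for `j ≠ i` their sum gives `η⁰(T_j) = s (l + r)`. So `η` is determined by the
pair `(l, r)`, and every pair occurs. A family of degree `-1` is a single morphism `p` from `T_i` to
the summand `T_i` of `β T_i`, and its differential is the transformation of the pair `(-p, p)`.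
Hence the coboundaries are the pairs with `l + r = 0`, and `η ↦ l + r` identifies `HH⁰` with `k[s]`.
The transformation `η_ε` is the one of the pair `(h, h)` with `2 h = ∑ ε_ℓ s^(ℓ-1)`, and `2 h` runs
through `k[s]` once.
-/

namespace Braid

namespace Tw

variable {C : Type u} [Category.{v} C] [Preadditive C] {X Y Z : Tw C}

/-- The subgroup of morphisms of degree `g`. -/
def homogeneous (X Y : Tw C) (g : ℤ) : AddSubgroup (Hom X Y) where
  carrier := {φ | φ.HasDeg g}
  zero_mem' _ _ _ := rfl
  add_mem' {φ ψ} hφ hψ a b h := by simp [hφ a b h, hψ a b h]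
  neg_mem' {φ} hφ a b h := by simp [hφ a b h]

theorem units_smul_mem_homogeneous (u : ℤˣ) {g : ℤ} {φ : Hom X Y} (hφ : φ ∈ homogeneous X Y g) :
    u • φ ∈ homogeneous X Y g :=
  zsmul_mem hφ (u : ℤ)

theorem μ₁_mem_homogeneous {g : ℤ} {φ : Hom X Y} (hφ : φ ∈ homogeneous X Y g) :
    μ₁ φ ∈ homogeneous X Y (g + 1) := by
  intro a c h
  simp only [μ₁]
  rw [Finset.sum_eq_zero, Finset.sum_eq_zero, sub_zero] <;> intro b _
  · by_cases hb : X.deg b = X.deg a + 1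
    · rw [hφ b c (by omega), Limits.comp_zero]
    · rw [X.δ_deg a b hb, Limits.zero_comp]
  · by_cases hb : Y.deg b = X.deg a + g
    · rw [Y.δ_deg b c (by omega), Limits.comp_zero, smul_zero]
    · rw [hφ a b hb, Limits.zero_comp, smul_zero]

theorem μ₂_mem_homogeneous {g h : ℤ} {ψ : Hom Y Z} {φ : Hom X Y} (hψ : ψ ∈ homogeneous Y Z h)
    (hφ : φ ∈ homogeneous X Y g) : μ₂ ψ φ ∈ homogeneous X Z (g + h) := by
  intro a c hc
  refine Finset.sum_eq_zero fun b _ => ?_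
  by_cases hb : Y.deg b = X.deg a + g
  · rw [hψ b c (by omega), Limits.comp_zero, smul_zero]
  · rw [hφ a b hb, Limits.zero_comp, smul_zero]

end Tw

section Differential

variable {k : Type*} [Field k] {C : Type u} [Category.{v} C] [Preadditive C] [Linear k C]
  {F G : AInfFunctor k C} {X Y Z : C} {g : ℤ} {η : Family F G}

theorem natDiffFun_hasDeg
    (hη : ∀ {X Y : C} (p : Quiver.Path X Y), (η X Y p).HasDeg (g - p.length))
    (p : Quiver.Path X Y) : (natDiffFun F G g η X Y p).HasDeg (g + 1 - p.length) := by
  have of_deg_eq {d e : ℤ} {φ : Tw.Hom (F.obj X) (G.obj Y)} (hφ : φ ∈ Tw.homogeneous _ _ d)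
      (h : d = e) : φ ∈ Tw.homogeneous _ _ e := h ▸ hφ
  change _ ∈ Tw.homogeneous _ _ _
  refine sub_mem (add_mem (add_mem ?_ (list_sum_mem ?_)) (list_sum_mem ?_)) (list_sum_mem ?_)
  · exact of_deg_eq (Tw.μ₁_mem_homogeneous (hη p)) (by ring)
  · simp only [List.forall_mem_map]
    intro s hs
    have := length_of_mem_splits p s hs
    exact of_deg_eq (Tw.μ₂_mem_homogeneous (G.map_deg s.2.2) (hη s.2.1)) (by omega)
  · simp only [List.forall_mem_map]
    intro s hs
    have := length_of_mem_splits p s hs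
    exact of_deg_eq (Tw.units_smul_mem_homogeneous _
      (Tw.μ₂_mem_homogeneous (hη s.2.2) (F.map_deg s.2.1))) (by omega)
  · simp only [List.forall_mem_map]
    intro c hc
    have := length_of_mem_contractions p c hc
    exact of_deg_eq (Tw.units_smul_mem_homogeneous _ (hη c.2)) (by omega)

variable (F G g η)

theorem natDiffFun_nil (X : C) :
    natDiffFun F G g η X X .nil = Tw.μ₁ (η X X .nil) := by
  simp [natDiffFun, splits, contractions, AInfFunctor.map_nil]

theorem natDiffFun_single (f : X ⟶ Y) :
    natDiffFun F G g η X Y (.cons .nil f) =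
      Tw.μ₁ (η X Y (.cons .nil f)) + Tw.μ₂ (G.map (.cons .nil f)) (η X X .nil)
        + (g - 1).negOnePow • Tw.μ₂ (η Y Y .nil) (F.map (.cons .nil f)) := by
  simp [natDiffFun, splits, contractions, AInfFunctor.map_nil, Int.negOnePow_neg]

theorem natDiffFun_pair (e : X ⟶ Y) (f : Y ⟶ Z) :
    natDiffFun F G g η X Z (.cons (.cons .nil e) f) =
      Tw.μ₁ (η X Z (.cons (.cons .nil e) f))
        + (Tw.μ₂ (G.map (.cons (.cons .nil e) f)) (η X X .nil)
          + Tw.μ₂ (G.map (.cons .nil f)) (η X Y (.cons .nil e)))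
        + ((g - 1).negOnePow • Tw.μ₂ (η Y Z (.cons .nil f)) (F.map (.cons .nil e))
          + Tw.μ₂ (η Z Z .nil) (F.map (.cons (.cons .nil e) f)))
        - (g - 1).negOnePow • η X Z (.cons .nil (e ≫ f)) := by
  have h2 : ((g - 1) * 2).negOnePow = 1 := Int.negOnePow_even _ (even_two.mul_left _)
  simp [natDiffFun, splits, contractions, AInfFunctor.map_nil, Int.negOnePow_neg, h2]

end Differential

section Rescaling

variable {k : Type u} [Field k]

variable (k) in
/-- The substitution `X = u²`. -/
noncomputable def substSq : k[X] →ₐ[k] FractionRing k[X] := aeval (root k ^ 2)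

theorem gauge_eq (a b : ℤ) (f : k[X]) : gauge a b f = substSq k f * root k ^ |a - b| := by
  have h : algebraMap k[X] (FractionRing k[X]) (expand k 2 f) = substSq k f := by
    rw [expand_eq_comp_X_pow, comp_eq_aeval, substSq, root, ← map_pow]
    exact (aeval_algebraMap_apply _ _ _).symm
  rw [gauge_def, h]

theorem substSq_injective : Function.Injective (substSq k) := fun p q h =>
  gauge_injective 0 0 (by simp [gauge_eq, h])

@[simp] theorem substSq_X : substSq k X = root k ^ 2 := aeval_X _

theorem gauge_mul (a b : ℤ) (p f : k[X]) : gauge a b (p * f) = substSq k p * gauge a b f := by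
  rw [gauge_eq, gauge_eq, map_mul, mul_assoc]

theorem gauge_sum {ι : Type*} (s : Finset ι) (a b : ℤ) (f : ι → k[X]) :
    gauge a b (∑ x ∈ s, f x) = ∑ x ∈ s, gauge a b (f x) := by
  simp only [gauge_eq, map_sum, Finset.sum_mul]

theorem gauge_ne_zero (a b : ℤ) {f : k[X]} (hf : f ≠ 0) : gauge a b f ≠ 0 := fun h =>
  hf (gauge_injective a b (h.trans (gauge_zero a b).symm))

end Rescaling

section Columns

variable {k : Type u} [Field k] {n i : ℕ} (hi : 0 < i) (hn : i < n)

/-- The morphisms `T_j ⟶ β T_l` of twisted complexes. -/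
abbrev BraidHom (Y Z : KLRW k n) : Type u :=
  Tw.Hom ((incl k (KLRW k n)).obj Y) ((braidFunctor hi hn).obj Z)

variable {hi hn} {Y Z W : KLRW k n}

/-- The entry of a morphism `T_j ⟶ β T_l` at a summand of `β T_l`, as a polynomial. -/
def entry (φ : BraidHom hi hn Y Z) (t : Slot) (ht : t = .main ∨ Z.pos = i) : k[X] := φ () ⟨t, ht⟩

/-- The rescaled entries of a morphism `Y ⟶ β Z`, with the value `0` at the absent summands. -/
noncomputable def column : BraidHom hi hn Y Z →+ (Slot → FractionRing k[X]) where
  toFun φ t := if h : t = .main ∨ Z.pos = i then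
    gauge Y.pos (slotPos i Z.pos t) (entry φ t h) else 0
  map_zero' := by
    funext t
    split_ifs
    exacts [gauge_zero _ _, rfl]
  map_add' φ ψ := by
    funext t
    simp only [Pi.add_apply]
    split_ifs
    exacts [gauge_add _ _ _ _, (add_zero 0).symm]

theorem column_apply (φ : BraidHom hi hn Y Z) {t : Slot} (ht : t = .main ∨ Z.pos = i) :
    column φ t = gauge Y.pos (slotPos i Z.pos t) (entry φ t ht) :=
  dif_pos ht

theorem column_of_absent (φ : BraidHom hi hn Y Z) {t : Slot} (ht : ¬(t = .main ∨ Z.pos = i)) :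
    column φ t = 0 :=
  dif_neg ht

theorem column_injective : Function.Injective (column : BraidHom hi hn Y Z → _) := by
  intro φ ψ h
  funext a ⟨t, ht⟩
  have := congrFun h t
  rw [column_apply φ ht, column_apply ψ ht] at this
  exact gauge_injective _ _ this

theorem column_units_smul (u : ℤˣ) (φ : BraidHom hi hn Y Z) (t : Slot) :
    column (u • φ) t = u * column φ t :=
  (congrFun (map_zsmul column (u : ℤ) φ) t).trans (zsmul_eq_mul _ _)

theorem column_eq_zero_of_hasDeg {φ : BraidHom hi hn Y Z} {g : ℤ} (hφ : φ.HasDeg g) {t : Slot}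
    (ht : slotDeg i Z.pos t ≠ g) : column φ t = 0 := by
  by_cases h : t = .main ∨ Z.pos = i
  · have : entry φ t h = 0 := hφ () ⟨t, h⟩ fun h => ht (h.trans (zero_add g))
    rw [column_apply φ h, this, gauge_zero]
  · exact column_of_absent φ h

theorem Slot.sum_univ {M : Type*} [AddCommMonoid M] (f : Slot → M) :
    ∑ s, f s = f .main + f .left + f .right := by
  rw [add_assoc]
  simp [Finset.sum, Finset.univ, Fintype.elems]

theorem entry_μ₂_slotHom (Ψ : Slot → Slot → k[X]) (φ : BraidHom hi hn Y Z) (t : Slot)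
    (ht : t = .main ∨ W.pos = i) :
    entry (hi := hi) (hn := hn) (Z := W) (Tw.μ₂ (slotHom hi hn Z W Ψ) φ) t ht =
      ∑ r : {s : Slot // s = .main ∨ Z.pos = i}, (slotDeg i Z.pos r).negOnePow •
        (entry φ r r.2 * Ψ r t * X ^ crossing Y.pos (slotPos i Z.pos r) (slotPos i W.pos t)) := by
  unfold entry
  refine Eq.trans (Finset.sum_congr rfl fun r _ => ?_) rfl
  rw [← braidObj_pos hi hn Z r, ← braidObj_pos hi hn W ⟨t, ht⟩, ← sub_zero (slotDeg i Z.pos r.1)]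
  rfl

theorem column_μ₂_slotHom {Ψ : Slot → Slot → k[X]} {γ : Slot → Slot → FractionRing k[X]}
    {c : FractionRing k[X]} (φ : BraidHom hi hn Y Z)
    (hΨ : ∀ r t, (r = .main ∨ Z.pos = i) → (t = .main ∨ W.pos = i) →
      gauge (slotPos i Z.pos r) (slotPos i W.pos t) (Ψ r t) = γ r t * c)
    (hγ : ∀ r t, ¬(t = .main ∨ W.pos = i) → γ r t = 0) (t : Slot) :
    column (hi := hi) (hn := hn) (Z := W) (Tw.μ₂ (slotHom hi hn Z W Ψ) φ) t =
      (∑ r, (slotDeg i Z.pos r).negOnePow * (column φ r * γ r t)) * c := by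
  by_cases ht : t = .main ∨ W.pos = i
  · rw [column_apply _ ht, entry_μ₂_slotHom, gauge_sum, Finset.sum_mul]
    refine Fintype.sum_of_injective Subtype.val Subtype.val_injective _ _ (fun r hr => ?_)
      fun r => ?_
    · rw [column_of_absent φ (by simpa using hr)]
      ring
    · rw [gauge_units_smul, gauge_comp, column_apply φ r.2, hΨ r t r.2 ht, Units.smul_def,
        zsmul_eq_mul]
      ring
  · rw [column_of_absent _ ht, Finset.sum_eq_zero fun r _ => ?_, zero_mul]
    rw [hγ r t ht]
    ring

theorem column_μ₂_map_single (f : Z ⟶ W) (φ : BraidHom hi hn Y Z) (t : Slot) :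
    column (Tw.μ₂ ((braidFunctor hi hn).map (.cons .nil f)) φ) t =
      (∑ r, (slotDeg i Z.pos r).negOnePow * (column φ r * gauge₁ k i Z.pos W.pos r t)) *
        gauge Z.pos W.pos f := by
  refine column_μ₂_slotHom φ (fun r t => gauge_braid₁ Z.pos W.pos f r t) (fun r t ht => ?_) t
  obtain ⟨ht, hW⟩ := not_or.1 ht
  unfold gauge₁
  split_ifs <;> cases r <;> cases t <;> simp_all

theorem column_μ₂_map_pair {U : KLRW k n} (e : Z ⟶ U) (f : U ⟶ W) (φ : BraidHom hi hn Y Z)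
    (t : Slot) :
    column (Tw.μ₂ ((braidFunctor hi hn).map (.cons (.cons .nil e) f)) φ) t =
      (∑ r, (slotDeg i Z.pos r).negOnePow * (column φ r * gauge₂ k i Z.pos U.pos W.pos r t)) *
        (gauge Z.pos U.pos e * gauge U.pos W.pos f) := by
  refine column_μ₂_slotHom φ (fun r t => gauge_braid₂ Z.pos U.pos W.pos f e r t)
    (fun r t ht => ?_) t
  simp [gauge₂, (not_or.1 ht).2]

theorem μ₁_eq_μ₂_slotδ (φ : BraidHom hi hn Y Z) : Tw.μ₁ φ = Tw.μ₂ (slotHom hi hn Z Z slotδ) φ := by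
  funext a c
  refine (congrArg _ (Finset.sum_eq_zero fun b _ => ?_)).trans (sub_zero _)
  exact Limits.zero_comp

variable (k i) in
/-- The rescaled matrix of the differential of `β T_j`. -/
noncomputable def gaugeδ (j : ℤ) (r t : Slot) : FractionRing k[X] :=
  if j = i then match r, t with
    | .main, .left => root k
    | .main, .right => -root k
    | _, _ => 0
  else 0

theorem column_μ₁ (φ : BraidHom hi hn Y Z) (t : Slot) :
    column (Tw.μ₁ φ) t =
      ∑ r, (slotDeg i Z.pos r).negOnePow * (column φ r * gaugeδ k i Z.pos r t) := by
  have hδ r t (hr : r = .main ∨ Z.pos = i) (ht : t = .main ∨ Z.pos = i) :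
      gauge (slotPos i Z.pos r) (slotPos i Z.pos t) (slotδ r t : k[X]) =
        gaugeδ k i Z.pos r t * 1 := by
    rw [gauge_slotδ _ _ _ hr ht, mul_one]
    rcases ht with rfl | hZ
    · cases r <;> simp [gaugeδ]
    · cases r <;> cases t <;> simp [gaugeδ, hZ]
  have hγ r t (ht : ¬(t = .main ∨ Z.pos = i)) : gaugeδ k i Z.pos r t = 0 :=
    if_neg (not_or.1 ht).2
  refine (congrFun (congrArg column (μ₁_eq_μ₂_slotδ φ)) t).trans
    ((column_μ₂_slotHom φ hδ hγ t).trans (mul_one _))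

theorem entry_μ₂_incl (f : Y ⟶ Z) (φ : BraidHom hi hn Z W) (t : Slot)
    (ht : t = .main ∨ W.pos = i) :
    entry (Tw.μ₂ φ ((incl k (KLRW k n)).map (.cons .nil f))) t ht =
      HMul.hMul (α := k[X]) f (entry φ t ht) * X ^ crossing Y.pos Z.pos (slotPos i W.pos t) := by
  unfold entry
  refine (Tw.single_sum Z _).trans ((one_smul ℤˣ _).trans ?_)
  rw [← braidObj_pos hi hn W ⟨t, ht⟩]
  rfl

theorem column_μ₂_incl (f : Y ⟶ Z) (φ : BraidHom hi hn Z W) :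
    column (Tw.μ₂ φ ((incl k (KLRW k n)).map (.cons .nil f))) =
      gauge Y.pos Z.pos f • column φ := by
  funext t
  by_cases ht : t = .main ∨ W.pos = i
  · rw [column_apply _ ht, entry_μ₂_incl, gauge_comp, Pi.smul_apply, column_apply φ ht, smul_eq_mul]
  · rw [column_of_absent _ ht, Pi.smul_apply, column_of_absent φ ht, smul_zero]

end Columns

section ShortFamily

variable {k : Type*} [Field k] {C : Type u} [Category.{v} C] [Preadditive C] [Linear k C]
  {F G : AInfFunctor k C} {g : ℤ}

/-- The family with components `η⁰` and `η¹`, and `η^d = 0` for `d ≥ 2`. -/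
def shortFamily (η₀ : ∀ X, Tw.Hom (F.obj X) (G.obj X))
    (η₁ : ∀ X Y, (X ⟶ Y) →ₗ[k] Tw.Hom (F.obj X) (G.obj Y)) : Family F G
  | X, _, .nil => η₀ X
  | X, Y, .cons .nil f => η₁ X Y f
  | _, _, .cons (.cons _ _) _ => 0

theorem shortFamily_eq_zero {η₀ : ∀ X, Tw.Hom (F.obj X) (G.obj X)}
    {η₁ : ∀ X Y, (X ⟶ Y) →ₗ[k] Tw.Hom (F.obj X) (G.obj Y)} {X Y : C} (p : Quiver.Path X Y)
    (hp : 2 ≤ p.length) : shortFamily η₀ η₁ X Y p = 0 := by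
  match p, hp with
  | .cons (.cons _ _) _, _ => rfl

theorem shortFamily_mem_preNat {η₀ : ∀ X, Tw.Hom (F.obj X) (G.obj X)}
    {η₁ : ∀ X Y, (X ⟶ Y) →ₗ[k] Tw.Hom (F.obj X) (G.obj Y)} (h₀ : ∀ X, (η₀ X).HasDeg g)
    (h₁ : ∀ X Y f, (η₁ X Y f).HasDeg (g - 1)) : shortFamily η₀ η₁ ∈ preNat F G g := by
  refine ⟨fun {X Y Z W} p q => ?_, fun {X Y} p => ?_⟩
  · by_cases hpq : p.length = 0 ∧ q.length = 0
    · match p, q, hpq with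
      | .nil, .nil, _ => exact (η₁ X Z).isLinear
    · have h (f : Y ⟶ Z) : shortFamily η₀ η₁ X W ((p.cons f).comp q) = 0 :=
        shortFamily_eq_zero _ (by rw [Quiver.Path.length_comp, Quiver.Path.length_cons]; omega)
      simp only [h]
      exact (0 : (Y ⟶ Z) →ₗ[k] Tw.Hom (F.obj X) (G.obj W)).isLinear
  · match p with
    | .nil => simpa [shortFamily] using h₀ X
    | .cons .nil f => simpa [shortFamily] using h₁ X Y f
    | .cons (.cons _ _) _ => exact fun _ _ _ => rfl

end ShortFamily

section Columns

variable {k : Type u} [Field k] {n i : ℕ} {hi : 0 < i} {hn : i < n} {Y Z : KLRW k n}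

/-- The morphism `T_j ⟶ β T_l` with prescribed entries. -/
def ofSlots (hi : 0 < i) (hn : i < n) (Y Z : KLRW k n) :
    (Slot → k[X]) →ₗ[k] BraidHom hi hn Y Z where
  toFun Φ _ t := Φ t.1
  map_add' _ _ := rfl
  map_smul' _ _ := rfl

theorem column_ofSlots (Φ : Slot → k[X]) (t : Slot) :
    column (ofSlots hi hn Y Z Φ) t =
      if t = .main ∨ Z.pos = i then gauge Y.pos (slotPos i Z.pos t) (Φ t) else 0 := by
  split_ifs with ht
  exacts [column_apply _ ht, column_of_absent _ ht]

theorem ofSlots_hasDeg {Φ : Slot → k[X]} {g : ℤ}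
    (hΦ : ∀ t, t = .main ∨ Z.pos = i → slotDeg i Z.pos t ≠ g → Φ t = 0) :
    (ofSlots hi hn Y Z Φ).HasDeg g :=
  fun _ t ht => hΦ t.1 t.2 fun h => ht (h.trans (zero_add g).symm)

/-- The map `f ↦ c f` into the summand `T_l` of `β T_l`. -/
noncomputable def mulMain (hi : 0 < i) (hn : i < n) (Y Z : KLRW k n) (c : k[X]) :
    (Y ⟶ Z) →ₗ[k] BraidHom hi hn Y Z where
  toFun f := ofSlots hi hn Y Z (LinearMap.single k _ .main (LinearMap.mulLeft k c f))
  map_add' f f' := by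
    rw [← map_add, ← map_add]
    exact congrArg _ (congrArg _ (map_add (LinearMap.mulLeft k c) f f'))
  map_smul' r f := by
    rw [RingHom.id_apply, ← map_smul, ← map_smul]
    exact congrArg _ (congrArg _ (map_smul (LinearMap.mulLeft k c) r f))

theorem mulMain_apply (c : k[X]) (f : Y ⟶ Z) :
    mulMain hi hn Y Z c f =
      ofSlots hi hn Y Z (LinearMap.single k _ .main (LinearMap.mulLeft k c f)) := rfl

theorem column_mulMain (c : k[X]) (f : Y ⟶ Z) (t : Slot) :
    column (mulMain hi hn Y Z c f) t =
      if t = .main then substSq k c * gauge Y.pos Z.pos f else 0 := by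
  rw [mulMain_apply, column_ofSlots]
  cases t <;> simp [slotPos, gauge_mul]

theorem mulMain_hasDeg {c : k[X]} {g : ℤ} (hc : slotDeg i Z.pos .main ≠ g → c = 0) (f : Y ⟶ Z) :
    (mulMain hi hn Y Z c f).HasDeg g := by
  rw [mulMain_apply]
  refine ofSlots_hasDeg fun t _ h => ?_
  cases t
  · simp [hc h]
  · rfl
  · rfl

theorem eq_zero_of_hasDeg {φ : BraidHom hi hn Y Z} {g : ℤ} (hφ : φ.HasDeg g) (hg : g < -1) :
    φ = 0 := by
  refine column_injective (funext fun t => ?_)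
  rw [map_zero, Pi.zero_apply, column_eq_zero_of_hasDeg hφ]
  unfold slotDeg
  cases t <;> dsimp only <;> (try split_ifs) <;> omega

end Columns

section Relations

variable {k : Type u} [Field k] {n i : ℕ} {hi : 0 < i} {hn : i < n} {Y Z W : KLRW k n} {g : ℤ}
  (η : Family (incl k (KLRW k n)) (braidFunctor hi hn))

theorem column_natDiffFun_nil (t : Slot) :
    column (natDiffFun _ (braidFunctor hi hn) g η Y Y .nil) t =
      ∑ r, (slotDeg i Y.pos r).negOnePow * (column (η Y Y .nil) r * gaugeδ k i Y.pos r t) := by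
  rw [natDiffFun_nil, column_μ₁]

theorem column_natDiffFun_single (f : Y ⟶ Z) (t : Slot) :
    column (natDiffFun _ (braidFunctor hi hn) g η Y Z (.cons .nil f)) t =
      (∑ r, (slotDeg i Z.pos r).negOnePow * (column (η Y Z (.cons .nil f)) r *
          gaugeδ k i Z.pos r t))
      + (∑ r, (slotDeg i Y.pos r).negOnePow * (column (η Y Y .nil) r *
          gauge₁ k i Y.pos Z.pos r t)) * gauge Y.pos Z.pos f
      + (g - 1).negOnePow * (gauge Y.pos Z.pos f * column (η Z Z .nil) t) := by
  rw [natDiffFun_single, map_add, map_add, Pi.add_apply, Pi.add_apply, column_μ₁,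
    column_μ₂_map_single, column_units_smul, column_μ₂_incl]
  rfl

theorem column_natDiffFun_pair (e : Y ⟶ Z) (f : Z ⟶ W) (t : Slot) :
    column (natDiffFun _ (braidFunctor hi hn) g η Y W (.cons (.cons .nil e) f)) t =
      (∑ r, (slotDeg i W.pos r).negOnePow * (column (η Y W (.cons (.cons .nil e) f)) r *
          gaugeδ k i W.pos r t))
      + ((∑ r, (slotDeg i Y.pos r).negOnePow * (column (η Y Y .nil) r *
            gauge₂ k i Y.pos Z.pos W.pos r t)) * (gauge Y.pos Z.pos e * gauge Z.pos W.pos f)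
        + (∑ r, (slotDeg i Z.pos r).negOnePow * (column (η Y Z (.cons .nil e)) r *
            gauge₁ k i Z.pos W.pos r t)) * gauge Z.pos W.pos f)
      + (g - 1).negOnePow * (gauge Y.pos Z.pos e * column (η Z W (.cons .nil f)) t)
      - (g - 1).negOnePow * column (η Y W (.cons .nil (e ≫ f))) t := by
  have hF : (incl k (KLRW k n)).map (.cons (.cons .nil e) f) = 0 := rfl
  rw [natDiffFun_pair, hF, Tw.μ₂_zero_right, add_zero]
  simp only [map_add, map_sub, Pi.add_apply, Pi.sub_apply, column_units_smul, column_μ₁,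
    column_μ₂_map_single, column_μ₂_map_pair, column_μ₂_incl]
  rfl

end Relations

section Cocycle

variable {k : Type u} [Field k] {n i : ℕ} (hi : 0 < i) (hn : i < n)

/-- The polynomial `c` with `η¹(f) = c f` for `f : T_j ⟶ T_i` and `η = cocycle l r`. -/
noncomputable def cocycleCoeff (i : ℕ) (l r : k[X]) (j : ℤ) : k[X] :=
  if j < i then r else if i < j then -l else 0

/-- The natural transformation with `η⁰(T_i) = (l, r)`; the relations for `η` force
`η⁰(T_j) = s (l + r)` for `j ≠ i` and the formula for `η¹`. -/
noncomputable def cocycle (l r : k[X]) : Family (incl k (KLRW k n)) (braidFunctor hi hn) :=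
  shortFamily
    (fun Y => ofSlots hi hn Y Y fun
      | .main => if Y.pos = i then 0 else X * (l + r)
      | .left => l
      | .right => r)
    fun Y Z => mulMain hi hn Y Z (if Z.pos = i then cocycleCoeff i l r Y.pos else 0)

variable {hi hn} {Y Z W : KLRW k n}

theorem cocycle_mem_preNat (l r : k[X]) : cocycle hi hn l r ∈ preNat _ _ 0 := by
  refine shortFamily_mem_preNat (fun Y => ofSlots_hasDeg fun t _ h => ?_)
    fun Y Z f => mulMain_hasDeg (fun h => if_neg ?_) f
  · cases t
    · exact if_pos (by simpa [slotDeg] using h)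
    · exact absurd rfl h
    · exact absurd rfl h
  · simpa [slotDeg] using h

theorem column_cocycle_nil (l r : k[X]) (t : Slot) :
    column (cocycle hi hn l r Y Y .nil) t = match t with
      | .main => if Y.pos = i then 0 else root k ^ 2 * (substSq k l + substSq k r)
      | .left => if Y.pos = i then root k * substSq k l else 0
      | .right => if Y.pos = i then root k * substSq k r else 0 := by
  refine (column_ofSlots _ t).trans ?_
  by_cases hY : Y.pos = i <;> cases t <;> simp [slotPos, gauge_eq, hY, mul_comm]

theorem column_cocycle_single (l r : k[X]) (f : Y ⟶ Z) (t : Slot) :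
    column (cocycle hi hn l r Y Z (.cons .nil f)) t = if t = .main ∧ Z.pos = i then
      substSq k (cocycleCoeff i l r Y.pos) * gauge Y.pos Z.pos f else 0 := by
  refine (column_mulMain _ f t).trans ?_
  by_cases hZ : Z.pos = i <;> simp [hZ]

theorem substSq_cocycleCoeff (l r : k[X]) (j : ℤ) : substSq k (cocycleCoeff i l r j) =
    if j < i then substSq k r else if i < j then -substSq k l else 0 := by
  unfold cocycleCoeff
  split_ifs <;> simp

theorem natDiffFun_cocycle_nil (l r : k[X]) :
    natDiffFun _ _ 0 (cocycle hi hn l r) Y Y .nil = 0 := by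
  refine column_injective (funext fun t => ?_)
  rw [column_natDiffFun_nil, map_zero]
  by_cases hY : Y.pos = i <;> cases t <;>
    simp [Slot.sum_univ, gaugeδ, column_cocycle_nil, hY]

theorem natDiffFun_cocycle_single (l r : k[X]) (f : Y ⟶ Z) :
    natDiffFun _ _ 0 (cocycle hi hn l r) Y Z (.cons .nil f) = 0 := by
  refine column_injective (funext fun t => ?_)
  rw [column_natDiffFun_single, map_zero]
  rcases vertex_cases Y.pos i with ⟨hY, hY', hY''⟩ | hY | ⟨hY, hY', hY''⟩ <;>
    by_cases hZ : Z.pos = i <;> cases t <;>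
    simp [Slot.sum_univ, slotDeg, gaugeδ, gauge₁, column_cocycle_nil, column_cocycle_single,
      substSq_cocycleCoeff, *] <;> field_simp <;> ring

theorem natDiffFun_cocycle_pair (l r : k[X]) (e : Y ⟶ Z) (f : Z ⟶ W) :
    natDiffFun _ _ 0 (cocycle hi hn l r) Y W (.cons (.cons .nil e) f) = 0 := by
  have hu : root k ≠ 0 := root_ne_zero
  have hef : gauge Y.pos W.pos (e ≫ f) = gauge Y.pos Z.pos e * gauge Z.pos W.pos f :=
    gauge_comp ..
  have h₂ : cocycle hi hn l r Y W (.cons (.cons .nil e) f) = 0 := rfl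
  refine column_injective (funext fun t => ?_)
  rw [column_natDiffFun_pair, map_zero, h₂]
  simp only [column_cocycle_single, hef]
  rcases vertex_cases Y.pos i with ⟨hY, hY', hY''⟩ | hY | ⟨hY, hY', hY''⟩ <;>
    rcases vertex_cases Z.pos i with ⟨hZ, hZ', hZ''⟩ | hZ | ⟨hZ, hZ', hZ''⟩ <;>
    by_cases hW : W.pos = i <;> cases t <;>
    simp [Slot.sum_univ, slotDeg, gauge₁, gauge₂, column_cocycle_nil, substSq_cocycleCoeff, *] <;>
    field_simp <;> ring

theorem cocycle_mem_natTrans (l r : k[X]) : cocycle hi hn l r ∈ natTrans _ _ 0 := by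
  refine ⟨cocycle_mem_preNat l r, ?_⟩
  funext Y Z p
  match p with
  | .nil => exact natDiffFun_cocycle_nil l r
  | .cons .nil f => exact natDiffFun_cocycle_single l r f
  | .cons (.cons .nil e) f => exact natDiffFun_cocycle_pair l r e f
  | .cons (.cons (.cons p d) e) f =>
    refine eq_zero_of_hasDeg (natDiffFun_hasDeg (cocycle_mem_preNat l r).2 _) ?_
    simp only [Quiver.Path.length_cons]
    omega

end Cocycle

theorem KLRW.pos_injective {k : Type u} {n : ℕ} :
    Function.Injective (KLRW.pos : KLRW k n → ℤ) := by
  rintro ⟨a⟩ ⟨b⟩ h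
  exact congrArg KLRW.mk (Fin.ext (Int.ofNat_inj.1 h))

section Classification

variable {k : Type u} [Field k] {n i : ℕ} {hi : 0 < i} {hn : i < n} {Y Z T : KLRW k n}
  {η : Family (incl k (KLRW k n)) (braidFunctor hi hn)}

theorem column_entry_left (φ : BraidHom hi hn T T) (hT : T.pos = i) :
    column φ .left = root k * substSq k (entry φ .left (.inr hT)) := by
  rw [column_apply φ (.inr hT), gauge_eq, mul_comm]
  simp [slotPos, hT]

theorem column_entry_right (φ : BraidHom hi hn T T) (hT : T.pos = i) :
    column φ .right = root k * substSq k (entry φ .right (.inr hT)) := by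
  rw [column_apply φ (.inr hT), gauge_eq, mul_comm]
  simp [slotPos, hT]

theorem column_natDiffFun_single_eq_zero (hη : η ∈ natTrans _ _ 0) (f : Y ⟶ Z) (t : Slot) :
    column (natDiffFun _ _ 0 η Y Z (.cons .nil f)) t = 0 := by
  have h : natDiffFun _ _ 0 η = 0 := hη.2
  rw [h]
  exact congrFun (map_zero column) t

theorem root_mul_column_single_main_left (hη : η ∈ natTrans _ _ 0) (hT : T.pos = i) (f : Y ⟶ T) :
    root k * column (η Y T (.cons .nil f)) .main =
      ((if Y.pos < i then (root k)⁻¹ * column (η Y Y .nil) .main else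
        if Y.pos = i then column (η Y Y .nil) .left else 0) - column (η T T .nil) .left) *
        gauge Y.pos T.pos f := by
  refine sub_eq_zero.1 (neg_eq_zero.1
    (Eq.trans ?_ (column_natDiffFun_single_eq_zero hη f .left)))
  rw [column_natDiffFun_single]
  rcases vertex_cases Y.pos i with ⟨hY, hY', hY''⟩ | hY | ⟨hY, hY', hY''⟩ <;>
    simp [Slot.sum_univ, slotDeg, gaugeδ, gauge₁, *] <;> ring

theorem root_mul_column_single_main_right (hη : η ∈ natTrans _ _ 0) (hT : T.pos = i) (f : Y ⟶ T) :
    root k * column (η Y T (.cons .nil f)) .main =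
      (column (η T T .nil) .right - if i < Y.pos then (root k)⁻¹ * column (η Y Y .nil) .main else
        if Y.pos = i then column (η Y Y .nil) .right else 0) * gauge Y.pos T.pos f := by
  refine sub_eq_zero.1 (Eq.trans ?_ (column_natDiffFun_single_eq_zero hη f .right))
  rw [column_natDiffFun_single]
  rcases vertex_cases Y.pos i with ⟨hY, hY', hY''⟩ | hY | ⟨hY, hY', hY''⟩ <;>
    simp [Slot.sum_univ, slotDeg, gaugeδ, gauge₁, *] <;> ring

theorem column_single_main (hη : η ∈ natTrans _ _ 0) (hT : T.pos = i) {l r : k[X]}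
    (hl : column (η T T .nil) .left = root k * substSq k l)
    (hr : column (η T T .nil) .right = root k * substSq k r) (f : Y ⟶ T) :
    column (η Y T (.cons .nil f)) .main =
      substSq k (cocycleCoeff i l r Y.pos) * gauge Y.pos T.pos f := by
  have hleft := root_mul_column_single_main_left hη hT f
  have hright := root_mul_column_single_main_right hη hT f
  refine mul_left_cancel₀ root_ne_zero ?_
  rw [substSq_cocycleCoeff]
  rcases vertex_cases Y.pos i with ⟨hY, hY', hY''⟩ | hY | ⟨hY, hY', hY''⟩
  · rw [if_pos hY, hright, if_neg hY'', if_neg hY', hr]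
    ring
  · obtain rfl : Y = T := KLRW.pos_injective (hY.trans hT.symm)
    rw [hright, if_neg hY.le.not_gt, if_pos hY, if_neg hY.ge.not_gt, if_neg hY.le.not_gt]
    ring
  · rw [if_neg hY'', if_pos hY, hleft, if_neg hY'', if_neg hY', hl]
    ring

theorem column_nil_main (hη : η ∈ natTrans _ _ 0) (hT : T.pos = i) {l r : k[X]}
    (hl : column (η T T .nil) .left = root k * substSq k l)
    (hr : column (η T T .nil) .right = root k * substSq k r) (hY : Y.pos ≠ i) :
    column (η Y Y .nil) .main = root k ^ 2 * (substSq k l + substSq k r) := by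
  let f : Y ⟶ T := (1 : k[X])
  have hf : gauge Y.pos T.pos f ≠ 0 := gauge_ne_zero _ _ one_ne_zero
  have h := mul_right_cancel₀ hf ((root_mul_column_single_main_left hη hT f).symm.trans
    (root_mul_column_single_main_right hη hT f))
  refine mul_left_cancel₀ (inv_ne_zero (root_ne_zero (k := k))) ?_
  have hu : (root k)⁻¹ * root k = 1 := inv_mul_cancel₀ root_ne_zero
  rw [hl, hr, if_neg hY, if_neg hY] at h
  rcases hY.lt_or_gt with hY | hY
  · rw [if_pos hY, if_neg hY.not_gt] at h
    linear_combination h - root k * (substSq k l + substSq k r) * hu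
  · rw [if_pos hY, if_neg hY.not_gt] at h
    linear_combination h - root k * (substSq k l + substSq k r) * hu

theorem eq_cocycle (hη : η ∈ natTrans _ _ 0) (hT : T.pos = i) :
    η = cocycle hi hn (entry (η T T .nil) .left (.inr hT))
      (entry (η T T .nil) .right (.inr hT)) := by
  have hl := column_entry_left (η T T .nil) hT
  have hr := column_entry_right (η T T .nil) hT
  funext Y Z p
  match p with
  | .nil =>
    refine column_injective (funext fun t => ?_)
    rw [column_cocycle_nil]
    by_cases hY : Y.pos = i
    · obtain rfl : Y = T := KLRW.pos_injective (hY.trans hT.symm)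
      cases t
      · simpa [hY] using column_eq_zero_of_hasDeg (hη.1.2 .nil) (by simp [slotDeg, hY])
      · simpa [hY] using hl
      · simpa [hY] using hr
    · cases t
      · simpa [hY] using column_nil_main hη hT hl hr hY
      · simpa [hY] using column_of_absent _ (by simp [hY])
      · simpa [hY] using column_of_absent _ (by simp [hY])
  | .cons .nil f =>
    refine column_injective (funext fun t => ?_)
    rw [column_cocycle_single]
    split_ifs with h
    · obtain ⟨rfl, hZ⟩ := h
      obtain rfl : Z = T := KLRW.pos_injective (hZ.trans hT.symm)
      exact column_single_main hη hT hl hr f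
    · refine column_eq_zero_of_hasDeg (hη.1.2 _) ?_
      cases t <;> simp_all [slotDeg]
  | .cons (.cons p e) f =>
    refine eq_zero_of_hasDeg (hη.1.2 _) ?_
    simp only [Quiver.Path.length_cons]
    omega

end Classification

section Cohomology

variable {k : Type u} [Field k] {n i : ℕ} (hi : 0 < i) (hn : i < n)

/-- The family of degree `-1` whose only component is the morphism `p` from `T_i` to the summand
`T_i` of `β T_i`. -/
noncomputable def pointFamily (p : k[X]) : Family (incl k (KLRW k n)) (braidFunctor hi hn) :=
  shortFamily (fun Y => ofSlots hi hn Y Y (Pi.single .main (if Y.pos = i then p else 0)))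
    fun _ _ => 0

variable {hi hn} {Y Z : KLRW k n}

theorem pointFamily_mem_preNat (p : k[X]) : pointFamily hi hn p ∈ preNat _ _ (0 - 1) := by
  refine shortFamily_mem_preNat (fun Y => ofSlots_hasDeg fun t _ h => ?_) fun _ _ _ _ _ _ => rfl
  cases t
  · have hY : Y.pos ≠ i := by simpa [slotDeg] using h
    simp [hY]
  · rfl
  · rfl

theorem column_pointFamily_nil (p : k[X]) (t : Slot) :
    column (pointFamily hi hn p Y Y .nil) t =
      if t = .main ∧ Y.pos = i then substSq k p else 0 := by
  refine (column_ofSlots _ t).trans ?_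
  cases t <;> by_cases hY : Y.pos = i <;> simp [slotPos, gauge_eq, hY]

theorem natDiffFun_pointFamily_nil (p : k[X]) :
    natDiffFun _ _ (0 - 1) (pointFamily hi hn p) Y Y .nil = cocycle hi hn (-p) p Y Y .nil := by
  refine column_injective (funext fun t => ?_)
  rw [column_natDiffFun_nil, column_cocycle_nil]
  by_cases hY : Y.pos = i <;> cases t <;>
    simp [slotDeg, gaugeδ, column_pointFamily_nil, hY, mul_comm]

theorem natDiffFun_pointFamily_single (p : k[X]) (f : Y ⟶ Z) :
    natDiffFun _ _ (0 - 1) (pointFamily hi hn p) Y Z (.cons .nil f) =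
      cocycle hi hn (-p) p Y Z (.cons .nil f) := by
  have hsign : ((0 : ℤ) - 1 - 1).negOnePow = 1 := Int.negOnePow_even _ ⟨-1, rfl⟩
  have h₁ : pointFamily hi hn p Y Z (.cons .nil f) = 0 := rfl
  refine column_injective (funext fun t => ?_)
  rw [column_natDiffFun_single, column_cocycle_single, h₁, hsign]
  rcases vertex_cases Y.pos i with ⟨hY, hY', hY''⟩ | hY | ⟨hY, hY', hY''⟩ <;>
    by_cases hZ : Z.pos = i <;> cases t <;>
    simp [slotDeg, gauge₁, column_pointFamily_nil, substSq_cocycleCoeff, mul_comm, *]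

theorem natDiff_pointFamily (p : k[X]) :
    natDiff _ _ (0 - 1) (pointFamily hi hn p) = cocycle hi hn (-p) p := by
  funext Y Z q
  match q with
  | .nil => exact natDiffFun_pointFamily_nil p
  | .cons .nil f => exact natDiffFun_pointFamily_single p f
  | .cons (.cons q e) f =>
    refine eq_zero_of_hasDeg (natDiffFun_hasDeg (pointFamily_mem_preNat p).2 _) ?_
    simp only [Quiver.Path.length_cons]
    omega

variable (k hi hn)

/-- The object `T_i`. -/
def middle : KLRW k n := ⟨⟨i, by omega⟩⟩

/-- The sum of the two entries of `η⁰(T_i)`, as polynomials in `s`. -/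
noncomputable def entrySum : Family (incl k (KLRW k n)) (braidFunctor hi hn) →ₗ[k] k[X] where
  toFun η := entry (η (middle k hn) _ .nil) .left (.inr rfl)
    + entry (η (middle k hn) _ .nil) .right (.inr rfl)
  map_add' _ _ := add_add_add_comm (G := k[X]) _ _ _ _
  map_smul' c _ := (smul_add (A := k[X]) c _ _).symm

variable {k hi hn}

theorem entrySum_cocycle (l r : k[X]) : entrySum k hi hn (cocycle hi hn l r) = l + r := rfl

theorem entrySum_natDiff (g : ℤ) (ζ : Family (incl k (KLRW k n)) (braidFunctor hi hn)) :
    entrySum k hi hn (natDiff _ _ g ζ) = 0 := by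
  let φ := natDiff _ _ g ζ (middle k hn) (middle k hn) .nil
  have hφ : column φ .left + column φ .right = 0 := by
    have hsum (t : Slot) := column_natDiffFun_nil (g := g) (Y := middle k hn) ζ t
    refine (congrArg₂ _ (hsum .left) (hsum .right)).trans ?_
    by_cases h : (middle k hn).pos = i <;> simp [Slot.sum_univ, gaugeδ, h]
  rw [column_entry_left φ rfl, column_entry_right φ rfl, ← mul_add, ← map_add] at hφ
  exact substSq_injective (((mul_eq_zero_iff_left root_ne_zero).1 hφ).trans (map_zero _).symm)

theorem ker_entrySum_domRestrict :
    LinearMap.ker ((entrySum k hi hn).domRestrict (natTrans _ _ 0)) =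
      (coboundaries _ _ 0).submoduleOf (natTrans _ _ 0) := by
  ext ⟨η, hη⟩
  rw [Submodule.submoduleOf, Submodule.mem_comap]
  constructor
  · intro h
    have hsum : entry (η (middle k hn) _ .nil) .left (.inr rfl)
      + entry (η (middle k hn) _ .nil) .right (.inr rfl) = 0 := h
    refine ⟨_, pointFamily_mem_preNat (entry (η (middle k hn) _ .nil) .right (.inr rfl)), ?_⟩
    rw [natDiff_pointFamily, ← eq_neg_of_add_eq_zero_left hsum]
    exact (eq_cocycle hη rfl).symm
  · rintro ⟨ζ, -, h⟩
    exact (congrArg (entrySum k hi hn) h.symm).trans (entrySum_natDiff _ ζ)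

theorem entrySum_domRestrict_surjective :
    Function.Surjective ((entrySum k hi hn).domRestrict (natTrans _ _ 0)) := fun p =>
  ⟨⟨_, cocycle_mem_natTrans p 0⟩, add_zero p⟩

variable (k hi hn) in
/-- The isomorphism `HH⁰ ≃ k[s]` induced by `entrySum`. -/
noncomputable def hhEquiv :
    HH (incl k (KLRW k n)) (braidFunctor hi hn) 0 ≃ₗ[k] k[X] :=
  Submodule.quotEquivOfEq _ _ ker_entrySum_domRestrict.symm ≪≫ₗ
    LinearMap.quotKerEquivOfSurjective _ entrySum_domRestrict_surjective

theorem hhEquiv_mk (η : natTrans (incl k (KLRW k n)) (braidFunctor hi hn) 0) :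
    hhEquiv k hi hn (Submodule.Quotient.mk η) = entrySum k hi hn η := rfl

end Cohomology

section Generators

variable {k : Type u} [Field k]

theorem half_smul_add_half_smul {M : Type v} [AddCommMonoid M] [Module k M] (h2 : (2 : k) ≠ 0)
    (x : M) : (2⁻¹ : k) • x + (2⁻¹ : k) • x = x := by
  rw [← add_smul, ← two_mul, mul_inv_cancel₀ h2, one_smul]

variable (k) in
/-- The generating polynomial `∑ ε_ℓ s^(ℓ-1)` of a finitely supported sequence `ε`. -/
noncomputable def genPoly : (ℕ+ →₀ k) ≃ₗ[k] k[X] :=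
  ((basisMonomials k).reindex Equiv.pnatEquivNat.symm).repr.symm

theorem genPoly_apply (ε : ℕ+ →₀ k) :
    genPoly k ε = ε.sum fun ℓ c => monomial ((ℓ : ℕ) - 1) c := by
  refine (Module.Basis.repr_symm_apply _ ε).trans (Finsupp.sum_congr fun ℓ _ => ?_)
  simp [PNat.natPred, smul_monomial]

theorem X_mul_genPoly (ε : ℕ+ →₀ k) : X * genPoly k ε = ε.sum fun ℓ c => monomial (ℓ : ℕ) c := by
  rw [genPoly_apply, Finsupp.mul_sum]
  refine Finsupp.sum_congr fun ℓ _ => ?_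
  rw [X_mul_monomial, Nat.sub_add_cancel ℓ.pos]

theorem half_smul_genPoly (ε : ℕ+ →₀ k) :
    (2⁻¹ : k) • genPoly k ε = ε.sum fun ℓ c => monomial ((ℓ : ℕ) - 1) (c / 2) := by
  rw [genPoly_apply, Finsupp.smul_sum]
  refine Finsupp.sum_congr fun ℓ _ => ?_
  rw [smul_monomial, smul_eq_mul, div_eq_inv_mul]

variable {n i : ℕ} (hi : 0 < i) (hn : i < n)

theorem sign_smul_eq_cocycleCoeff_mul (p f : k[X]) (j : ℤ) :
    (i - j : ℤ).sign • (p * f) = cocycleCoeff i p p j * f := by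
  unfold cocycleCoeff
  split_ifs with hlt hgt
  · rw [Int.sign_eq_one_of_pos (by omega), one_smul]
  · rw [Int.sign_eq_neg_one_of_neg (by omega), neg_one_smul, neg_mul]
  · rw [show (i - j : ℤ) = 0 by omega, Int.sign_zero, zero_smul, zero_mul]

theorem sign_smul_sum_eq_cocycleCoeff_mul (ε : ℕ+ →₀ k) (f : k[X]) (j : ℤ) :
    (i - j : ℤ).sign • (ε.sum fun ℓ c => monomial ((ℓ : ℕ) - 1) (c / 2) * f) =
      cocycleCoeff i ((2⁻¹ : k) • genPoly k ε) ((2⁻¹ : k) • genPoly k ε) j * f := by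
  rw [← sign_smul_eq_cocycleCoeff_mul, half_smul_genPoly, Finsupp.sum_mul]

theorem exists_cocycle_single_ne_zero (l : k[X]) {r : k[X]} (hr : r ≠ 0) :
    ∃ (Y Z : KLRW k n) (f : Y ⟶ Z), cocycle hi hn l r Y Z (.cons .nil f) ≠ 0 := by
  let Y : KLRW k n := ⟨0⟩
  let f : Y ⟶ middle k hn := (1 : k[X])
  have hY : Y.pos < i := Int.natCast_pos.2 hi
  refine ⟨Y, middle k hn, f, fun h => ?_⟩
  have hf := column_cocycle_single (hi := hi) (hn := hn) l r f .main
  rw [h, map_zero, if_pos ⟨rfl, rfl⟩, cocycleCoeff, if_pos hY] at hf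
  refine mul_ne_zero (fun h => hr (substSq_injective ?_)) (gauge_ne_zero _ _ one_ne_zero) hf.symm
  rw [h, map_zero]

theorem braidNat_eq_cocycle (h2 : (2 : k) ≠ 0) (ε : ℕ+ →₀ k) :
    braidNat hi hn ε = cocycle hi hn ((2⁻¹ : k) • genPoly k ε) ((2⁻¹ : k) • genPoly k ε) := by
  funext Y Z p
  match p with
  | .nil =>
    funext a ⟨t, ht⟩
    cases t
    · refine if_congr Iff.rfl rfl ?_
      rw [half_smul_add_half_smul h2, X_mul_genPoly]
    · exact (half_smul_genPoly ε).symm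
    · exact (half_smul_genPoly ε).symm
  | .cons .nil f =>
    funext a ⟨t, ht⟩
    cases t
    · refine (if_congr Iff.rfl (sign_smul_sum_eq_cocycleCoeff_mul ε f Y.pos) ?_).trans
        (ite_mul (α := k[X]) _ _ _ _).symm
      exact (zero_mul (M₀ := k[X]) f).symm
    · rfl
    · rfl
  | .cons (.cons _ _) _ => rfl

end Generators

end Braid

theorem mainTheorem7 {k : Type*} [Field k] (h2 : (2 : k) ≠ 0) (n i : ℕ) (hi : 0 < i) (hn : i < n) :
    ∃ Φ : (ℕ+ →₀ k) ≃ₗ[k]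
        Braid.HH (Braid.incl k (Braid.KLRW k n)) (Braid.braidFunctor hi hn) 0,
      (∀ ε : ℕ+ →₀ k,
        ∃ η : Braid.natTrans (Braid.incl k (Braid.KLRW k n)) (Braid.braidFunctor (k := k) hi hn) 0,
          η.1 = Braid.braidNat hi hn ε ∧ Φ ε = Submodule.Quotient.mk η) ∧
      ∀ ε : ℕ+ →₀ k, ε ≠ 0 →
        ∃ (Y Z : Braid.KLRW k n) (f : Y ⟶ Z),
          Braid.braidNat hi hn ε Y Z (Quiver.Path.cons .nil f) ≠ 0 := by
  refine ⟨Braid.genPoly k ≪≫ₗ (Braid.hhEquiv k hi hn).symm, fun ε => ?_, fun ε hε => ?_⟩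
  · refine ⟨⟨_, Braid.cocycle_mem_natTrans _ _⟩, (Braid.braidNat_eq_cocycle hi hn h2 ε).symm, ?_⟩
    rw [LinearEquiv.trans_apply, LinearEquiv.symm_apply_eq, Braid.hhEquiv_mk,
      Braid.entrySum_cocycle]
    exact (Braid.half_smul_add_half_smul h2 _).symm
  · rw [Braid.braidNat_eq_cocycle hi hn h2]
    refine Braid.exists_cocycle_single_ne_zero hi hn _ ?_
    exact smul_ne_zero (inv_ne_zero h2) ((Braid.genPoly k).map_ne_zero_iff.2 hε)
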